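/- Let $n\ge 2$, let $\omega\subset\mathbb R^{n-1}$ be a bounded Lipschitz domain (a bounded connected open set that near each boundary point is, after a rigid change of coordinates, the strict epigraph of a Lipschitz function), and let $0<\alpha<1$. Let $\eta\in C^{0,\alpha}(\omega)$ (extended continuously to $\overline\omega$) satisfy $\eta(x)\ge\eta_{\min}>0$ for all $x\in\overline\omega$ and $\eta=1$ on $\partial\omega$, and let $$\Omega_\eta=\{(x,x_n): x\in\omega,\ 0<x_n<\eta(x)\}\subset\mathbb R^n .$$ For $u\in C(\overline{\Omega_\eta})$ put $(\gamma_\eta u)(x)=u(x,\eta(x))$, $x\in\omega$. Let $H^1(\Omega_\eta)$ be the space of (real-valued) $u\in L^2(\Omega_\eta)$ with weak gradient in $L^2(\Omega_\eta)$, with $\|u\|_{H^1}^2=\|u\|_{L^2}^2+\|\nabla u\|_{L^2}^2$; let $H^0(\omega)=L^2(\omega)$, and for $0<s<1$ let $H^s(\omega)$ be the space of $u\in L^2(\omega)$ for which $$\|u\|_{H^s(\omega)}^2=\|u\|_{L^2(\omega)}^2+\int_{\omega\times\omega}\frac{|u(x_1)-u(x_2)|^2}{|x_1-x_2|^{n-1+2s}}\,dx_1\,dx_2<\infty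 .$$ Then for every $0\le s<\alpha/2$ the map $\gamma_\eta$ extends by continuity to a bounded linear operator from $H^1(\Omega_\eta)$ to $H^s(\omega)$; that is, $C(\overline{\Omega_\eta})\cap H^1(\Omega_\eta)$ is dense in $H^1(\Omega_\eta)$, and there is exactly one bounded linear operator $T:H^1(\Omega_\eta)\to H^s(\omega)$ with $Tu=\gamma_\eta u$ almost everywhere in $\omega$ for all $u\in C(\overline{\Omega_\eta})\cap H^1(\Omega_\eta)$. -/

import Mathlib

open MeasureTheory
open scoped NNReal ENNReal

/-- Bounded Lipschitz domain in `ℝ^d`: a bounded, connected (nonempty) open set which, near every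
boundary point and after the choice of a "vertical" unit vector `e`, is the strict epigraph of a
Lipschitz function `g` of the component `x - ⟪e, x⟫ e` orthogonal to `e`. -/
structure IsLipschitzDomain {d : ℕ} (ω : Set (EuclideanSpace ℝ (Fin d))) : Prop where
  isOpen : IsOpen ω
  isConnected : IsConnected ω
  isBounded : Bornology.IsBounded ω
  boundary : ∀ p ∈ frontier ω, ∃ e : EuclideanSpace ℝ (Fin d), ‖e‖ = 1 ∧
    ∃ (K : ℝ≥0) (g : EuclideanSpace ℝ (Fin d) → ℝ), LipschitzWith K g ∧
      ∃ r : ℝ, 0 < r ∧ ∀ x ∈ Metric.ball p r,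
        (x ∈ ω ↔ g (x - (inner ℝ e x) • e) < inner ℝ e x)

/-- The subgraph domain `Ω_η = {(x, t) : x ∈ ω, 0 < t < η x}`. The space `ℝ^(d+1)` is written as
`ℝ^d × ℝ`, with Lebesgue (product) measure. -/
def subgraphDomain {d : ℕ} (ω : Set (EuclideanSpace ℝ (Fin d)))
    (η : EuclideanSpace ℝ (Fin d) → ℝ) : Set (EuclideanSpace ℝ (Fin d) × ℝ) :=
  {z | z.1 ∈ ω ∧ 0 < z.2 ∧ z.2 < η z.1}

/-- `G` is the weak gradient of `u` in `Ω ⊆ ℝ^d × ℝ`: for all test functions `φ ∈ C_c^∞(Ω)` and all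
directions `v`, `∫_Ω u ∂_v φ = - ∫_Ω ⟪G, v⟫ φ`. Gradients take values in the Euclidean space
`WithLp 2 (ℝ^d × ℝ)`. -/
def HasWeakGradient {d : ℕ} (Ω : Set (EuclideanSpace ℝ (Fin d) × ℝ))
    (u : EuclideanSpace ℝ (Fin d) × ℝ → ℝ)
    (G : EuclideanSpace ℝ (Fin d) × ℝ → WithLp 2 (EuclideanSpace ℝ (Fin d) × ℝ)) : Prop :=
  ∀ φ : EuclideanSpace ℝ (Fin d) × ℝ → ℝ, ContDiff ℝ ((⊤ : ℕ∞) : WithTop ℕ∞) φ →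
    HasCompactSupport φ → tsupport φ ⊆ Ω →
    ∀ v : WithLp 2 (EuclideanSpace ℝ (Fin d) × ℝ),
      ∫ z in Ω, u z * fderiv ℝ φ z (v.fst, v.snd) = - ∫ z in Ω, inner ℝ (G z) v * φ z

theorem integrable_Lp_mul_of_compactSupport {d : ℕ} {Ω : Set (EuclideanSpace ℝ (Fin d) × ℝ)}
    {f ψ : EuclideanSpace ℝ (Fin d) × ℝ → ℝ} (hf : MemLp f 2 (volume.restrict Ω))
    (hψ : Continuous ψ) (hc : HasCompactSupport ψ) :
    Integrable (fun z => f z * ψ z) (volume.restrict Ω) :=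
  hf.integrable_mul (q := 2) ((hψ.memLp_of_hasCompactSupport hc).restrict Ω)

/-- The Sobolev space `H¹(Ω)`, as the space of pairs `(u, ∇u)` with `u ∈ L²(Ω)` having weak gradient
`∇u ∈ L²(Ω)`. The inherited norm is `‖u‖² = ‖u‖²_{L²} + ‖∇u‖²_{L²}`. -/
noncomputable def H1 {d : ℕ} (Ω : Set (EuclideanSpace ℝ (Fin d) × ℝ)) :
    Submodule ℝ (WithLp 2 (Lp ℝ 2 (volume.restrict Ω) ×
      Lp (WithLp 2 (EuclideanSpace ℝ (Fin d) × ℝ)) 2 (volume.restrict Ω))) where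
  carrier := {U | HasWeakGradient Ω U.fst U.snd}
  zero_mem' := by
    intro φ _ _ _ v
    have h1 : ∫ z in Ω, (0 : Lp ℝ 2 (volume.restrict Ω)) z * fderiv ℝ φ z (v.fst, v.snd) = 0 := by
      refine integral_eq_zero_of_ae ?_
      filter_upwards [Lp.coeFn_zero ℝ 2 (volume.restrict Ω)] with z hz
      simp only [hz, Pi.zero_apply, zero_mul]
    have h2 : ∫ z in Ω, inner ℝ ((0 : Lp (WithLp 2 (EuclideanSpace ℝ (Fin d) × ℝ)) 2
        (volume.restrict Ω)) z) v * φ z = 0 := by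
      refine integral_eq_zero_of_ae ?_
      filter_upwards [Lp.coeFn_zero (WithLp 2 (EuclideanSpace ℝ (Fin d) × ℝ)) 2
        (volume.restrict Ω)] with z hz
      rw [hz, Pi.zero_apply, inner_zero_left, zero_mul, Pi.zero_apply]
    exact h1.trans (by rw [WithLp.zero_snd, h2, neg_zero])
  add_mem' := by
    intro U V hU hV φ h1 h2 h3 v
    have hd : Continuous fun z => fderiv ℝ φ z (v.fst, v.snd) :=
      (h1.continuous_fderiv (by simp)).clm_apply continuous_const
    have hdc : HasCompactSupport fun z => fderiv ℝ φ z (v.fst, v.snd) :=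
      h2.fderiv_apply ℝ (v.fst, v.snd)
    have e1 : ∫ z in Ω, (U + V).fst z * fderiv ℝ φ z (v.fst, v.snd)
        = (∫ z in Ω, U.fst z * fderiv ℝ φ z (v.fst, v.snd))
          + ∫ z in Ω, V.fst z * fderiv ℝ φ z (v.fst, v.snd) := by
      rw [← integral_add (integrable_Lp_mul_of_compactSupport (Lp.memLp _) hd hdc)
        (integrable_Lp_mul_of_compactSupport (Lp.memLp _) hd hdc)]
      refine integral_congr_ae ?_
      filter_upwards [Lp.coeFn_add U.fst V.fst] with z hz
      rw [WithLp.add_fst, hz, Pi.add_apply, add_mul]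
    have e2 : ∫ z in Ω, inner ℝ ((U + V).snd z) v * φ z
        = (∫ z in Ω, inner ℝ (U.snd z) v * φ z) + ∫ z in Ω, inner ℝ (V.snd z) v * φ z := by
      rw [← integral_add
        (integrable_Lp_mul_of_compactSupport ((Lp.memLp _).inner_const v) h1.continuous h2)
        (integrable_Lp_mul_of_compactSupport ((Lp.memLp _).inner_const v) h1.continuous h2)]
      refine integral_congr_ae ?_
      filter_upwards [Lp.coeFn_add U.snd V.snd] with z hz
      rw [WithLp.add_snd, hz, Pi.add_apply, inner_add_left, add_mul]
    rw [e1, e2, hU φ h1 h2 h3 v, hV φ h1 h2 h3 v, neg_add]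
  smul_mem' := by
    intro c U hU φ h1 h2 h3 v
    have e1 : ∫ z in Ω, (c • U).fst z * fderiv ℝ φ z (v.fst, v.snd)
        = c * ∫ z in Ω, U.fst z * fderiv ℝ φ z (v.fst, v.snd) := by
      rw [← integral_const_mul]
      refine integral_congr_ae ?_
      filter_upwards [Lp.coeFn_smul c U.fst] with z hz
      rw [WithLp.smul_fst, hz, Pi.smul_apply, smul_eq_mul, mul_assoc]
    have e2 : ∫ z in Ω, inner ℝ ((c • U).snd z) v * φ z
        = c * ∫ z in Ω, inner ℝ (U.snd z) v * φ z := by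
      rw [← integral_const_mul]
      refine integral_congr_ae ?_
      filter_upwards [Lp.coeFn_smul c U.snd] with z hz
      rw [WithLp.smul_snd, hz, Pi.smul_apply, real_inner_smul_left, mul_assoc]
    rw [e1, e2, hU φ h1 h2 h3 v, mul_neg]

open Classical in
/-- The difference quotient `(u x - u y) / |x - y|^(d/2 + s)`, whose squared `L²(ω × ω)` norm is the
Gagliardo–Slobodeckij seminorm `∫∫ |u x - u y|² / |x - y|^(d + 2s)`. For `s = 0` it is replaced by
`0`, so that `H⁰ = L²`. -/
noncomputable def slobodeckijQuotient {d : ℕ} (s : ℝ) (u : EuclideanSpace ℝ (Fin d) → ℝ)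
    (p : EuclideanSpace ℝ (Fin d) × EuclideanSpace ℝ (Fin d)) : ℝ :=
  if s = 0 then 0 else (u p.1 - u p.2) / ‖p.1 - p.2‖ ^ ((d : ℝ) / 2 + s)

/-- The Sobolev space `H^s(ω)`, `0 ≤ s < 1`, with its intrinsic norm: the space of `u ∈ L²(ω)` whose
difference quotient is in `L²(ω × ω)`, each `u` being paired with that quotient. The inherited norm
is `‖u‖² = ‖u‖²_{L²(ω)} + ∫_{ω × ω} |u x - u y|² / |x - y|^(d + 2s)` for `0 < s < 1`, and the `L²`
norm for `s = 0`. -/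
noncomputable def Hs {d : ℕ} (ω : Set (EuclideanSpace ℝ (Fin d))) (s : ℝ) :
    Submodule ℝ (WithLp 2 (Lp ℝ 2 (volume.restrict ω) ×
      Lp ℝ 2 ((volume.restrict ω).prod (volume.restrict ω)))) where
  carrier := {U | U.snd =ᵐ[(volume.restrict ω).prod (volume.restrict ω)]
    slobodeckijQuotient s U.fst}
  zero_mem' := by
    have h := Lp.coeFn_zero ℝ 2 (volume.restrict ω)
    have h1 := Measure.quasiMeasurePreserving_fst (μ := volume.restrict ω)
      (ν := volume.restrict ω) |>.ae h
    have h2 := Measure.quasiMeasurePreserving_snd (μ := volume.restrict ω)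
      (ν := volume.restrict ω) |>.ae h
    change ((0 : Lp ℝ 2 ((volume.restrict ω).prod (volume.restrict ω))) : _ → ℝ) =ᵐ[_]
      slobodeckijQuotient s (0 : Lp ℝ 2 (volume.restrict ω))
    filter_upwards [h1, h2, Lp.coeFn_zero ℝ 2 ((volume.restrict ω).prod (volume.restrict ω))]
      with p hp1 hp2 hp
    simp only [slobodeckijQuotient, hp1, hp2, hp, Pi.zero_apply]
    simp
  add_mem' := by
    intro U V hU hV
    have h := Lp.coeFn_add U.fst V.fst
    have h1 := Measure.quasiMeasurePreserving_fst (μ := volume.restrict ω)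
      (ν := volume.restrict ω) |>.ae h
    have h2 := Measure.quasiMeasurePreserving_snd (μ := volume.restrict ω)
      (ν := volume.restrict ω) |>.ae h
    change ((U.snd + V.snd : Lp ℝ 2 _) : _ → ℝ) =ᵐ[_]
      slobodeckijQuotient s (U.fst + V.fst : Lp ℝ 2 _)
    filter_upwards [h1, h2, Lp.coeFn_add U.snd V.snd, hU, hV] with p hp1 hp2 hp hpU hpV
    rw [hp, Pi.add_apply, hpU, hpV]
    simp only [slobodeckijQuotient, hp1, hp2, Pi.add_apply]
    split_ifs <;> ring
  smul_mem' := by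
    intro c U hU
    have h := Lp.coeFn_smul c U.fst
    have h1 := Measure.quasiMeasurePreserving_fst (μ := volume.restrict ω)
      (ν := volume.restrict ω) |>.ae h
    have h2 := Measure.quasiMeasurePreserving_snd (μ := volume.restrict ω)
      (ν := volume.restrict ω) |>.ae h
    change ((c • U.snd : Lp ℝ 2 _) : _ → ℝ) =ᵐ[_]
      slobodeckijQuotient s (c • U.fst : Lp ℝ 2 _)
    filter_upwards [h1, h2, Lp.coeFn_smul c U.snd, hU] with p hp1 hp2 hp hpU
    rw [hp, Pi.smul_apply, hpU]
    simp only [slobodeckijQuotient, hp1, hp2, Pi.smul_apply, smul_eq_mul]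
    split_ifs <;> ring

/-- The trace `(γ_η f)(x) = f (x, η x)` of a function `f` continuous on the closure of `Ω_η`. -/
def graphTrace {d : ℕ} (η : EuclideanSpace ℝ (Fin d) → ℝ)
    (f : EuclideanSpace ℝ (Fin d) × ℝ → ℝ) (x : EuclideanSpace ℝ (Fin d)) : ℝ :=
  f (x, η x)

/-- `U ∈ H¹(Ω)` is (a.e. on `Ω` equal to) the function `f ∈ C(closure Ω)`. -/
def IsContinuousRep {d : ℕ} {Ω : Set (EuclideanSpace ℝ (Fin d) × ℝ)} (U : H1 Ω)
    (f : EuclideanSpace ℝ (Fin d) × ℝ → ℝ) : Prop :=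
  ContinuousOn f (closure Ω) ∧ U.1.fst =ᵐ[volume.restrict Ω] f

/-!
Let `φ` be a `C¹` function and let `x, y ∈ ω` be close. The traces `φ (x, η x)` and `φ (y, η y)`
are compared by moving down from the graph at `x`, by a length between `l` and `2l` with
`l ≈ |x - y| ^ α`, then horizontally along a detour `x → x + a → y + a → y` inside an interior
cone of `ω`, and then up at `y`. By Hölder continuity the oscillation of `η` along the detour is
at most `l`, so this path stays in `Ω_η`. Averaging over the length of the descent and applying
Cauchy–Schwarz bounds the squared increment by `l` times averages of `Γ`, where `Γ x` is the
integral of `|∇φ|²` over the vertical segment of `Ω_η` above `x`. Hence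
`∫ |γφ (x + h) - γφ x|² dx` is at most a constant times `|h| ^ α ‖φ‖²_{H¹}`, and
division by `|h| ^ (d + 2s)` leaves an integrable singularity exactly because `2s < α`.

For the density of the `C¹` functions in `H¹(Ω_η)`: locally a translation in the direction of a
cone combined with a vertical one carries the closure of `Ω_η` into `Ω_η`, so `u` can be
translated and then mollified, and the local approximations are glued by a partition of unity. If
`u` is continuous up to the boundary, these approximations converge uniformly, which identifies
the extension of the trace with `γ_η u`.
-/

section

open Metric Set Filter Topology
open scoped Convolution
open ContinuousLinearMap (lsmul)

local notation "𝔼^" d:max => EuclideanSpace ℝ (Fin d)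

section Inequalities

variable {F : Type*}

theorem sq_lintegral_le_measure_univ_mul {X : Type*} [MeasurableSpace X] (μ : Measure X)
    {g : X → ℝ≥0∞} (hg : AEMeasurable g μ) :
    (∫⁻ x, g x ∂μ) ^ 2 ≤ μ univ * ∫⁻ x, g x ^ 2 ∂μ := by
  have holder := ENNReal.lintegral_mul_le_Lp_mul_Lq μ Real.HolderConjugate.two_two hg
    (aemeasurable_const (b := (1 : ℝ≥0∞)))
  simp only [Pi.mul_apply, mul_one, ENNReal.one_rpow, lintegral_const, one_mul] at holder
  have sq_rpow_half (a : ℝ≥0∞) : (a ^ (1 / (2 : ℝ))) ^ 2 = a := by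
    rw [← ENNReal.rpow_natCast, ← ENNReal.rpow_mul]
    norm_num
  calc (∫⁻ x, g x ∂μ) ^ 2
      ≤ ((∫⁻ x, g x ^ (2 : ℝ) ∂μ) ^ (1 / (2 : ℝ)) * μ univ ^ (1 / (2 : ℝ))) ^ 2 := by gcongr
    _ = μ univ * ∫⁻ x, g x ^ 2 ∂μ := by
      rw [mul_pow, sq_rpow_half, sq_rpow_half, mul_comm]
      simp only [ENNReal.rpow_ofNat]

theorem enorm_add_sq_le [SeminormedAddCommGroup F] (a b : F) :
    ‖a + b‖ₑ ^ 2 ≤ 2 * (‖a‖ₑ ^ 2 + ‖b‖ₑ ^ 2) := by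
  have h : ‖a + b‖₊ ^ 2 ≤ 2 * (‖a‖₊ ^ 2 + ‖b‖₊ ^ 2) :=
    (pow_le_pow_left₀ zero_le (nnnorm_add_le a b) 2).trans add_sq_le
  simp only [enorm_eq_nnnorm]
  exact_mod_cast h

theorem enorm_add₃_sq_le [SeminormedAddCommGroup F] (a b c : F) :
    ‖a + b + c‖ₑ ^ 2 ≤ 3 * (‖a‖ₑ ^ 2 + ‖b‖ₑ ^ 2 + ‖c‖ₑ ^ 2) := by
  have h : ‖a + b + c‖₊ ^ 2 ≤ 3 * (‖a‖₊ ^ 2 + ‖b‖₊ ^ 2 + ‖c‖₊ ^ 2) := by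
    have triangle : ‖a + b + c‖₊ ≤ ‖a‖₊ + ‖b‖₊ + ‖c‖₊ := norm_add₃_le
    refine (pow_le_pow_left₀ zero_le triangle 2).trans ?_
    simpa [Fin.sum_univ_three] using
      sq_sum_le_card_mul_sum_sq (s := Finset.univ) (f := ![‖a‖₊, ‖b‖₊, ‖c‖₊])
  simp only [enorm_eq_nnnorm]
  exact_mod_cast h

theorem enorm_sub_sq_le_lintegral_deriv [NormedAddCommGroup F] [NormedSpace ℝ F] [CompleteSpace F]
    {f f' : ℝ → F} (hf : ∀ t, HasDerivAt f (f' t) t) (hf' : Continuous f') {a b : ℝ}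
    (hab : a ≤ b) :
    ‖f b - f a‖ₑ ^ 2 ≤ ENNReal.ofReal (b - a) * ∫⁻ t in Ioo a b, ‖f' t‖ₑ ^ 2 := by
  rw [← intervalIntegral.integral_eq_sub_of_hasDerivAt (fun t _ => hf t)
    (hf'.intervalIntegrable a b), intervalIntegral.integral_of_le hab, integral_Ioc_eq_integral_Ioo]
  calc ‖∫ t in Ioo a b, f' t‖ₑ ^ 2 ≤ (∫⁻ t in Ioo a b, ‖f' t‖ₑ) ^ 2 := by
        gcongr
        exact enorm_integral_le_lintegral_enorm _
    _ ≤ volume.restrict (Ioo a b) univ * ∫⁻ t in Ioo a b, ‖f' t‖ₑ ^ 2 :=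
        sq_lintegral_le_measure_univ_mul _ hf'.enorm.measurable.aemeasurable
    _ = _ := by rw [Measure.restrict_apply_univ, Real.volume_Ioo]

end Inequalities

section Gradient

variable {E : Type*} [NormedAddCommGroup E] [InnerProductSpace ℝ E] [CompleteSpace E]

/-- The gradient of `φ : E × ℝ → ℝ`, with values in the Euclidean product `WithLp 2 (E × ℝ)` as
required by `HasWeakGradient`; Mathlib's `gradient` is not available since `E × ℝ` carries the sup
norm. -/
noncomputable def prodGradient (φ : E × ℝ → ℝ) (z : E × ℝ) : WithLp 2 (E × ℝ) :=
  (InnerProductSpace.toDual ℝ (WithLp 2 (E × ℝ))).symm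
    (fderiv ℝ φ z ∘L (WithLp.prodContinuousLinearEquiv 2 ℝ E ℝ).toContinuousLinearMap)

theorem inner_prodGradient (φ : E × ℝ → ℝ) (z : E × ℝ) (v : WithLp 2 (E × ℝ)) :
    inner ℝ (prodGradient φ z) v = fderiv ℝ φ z (v.fst, v.snd) := by
  rw [prodGradient, InnerProductSpace.toDual_symm_apply]
  rfl

theorem continuous_prodGradient {φ : E × ℝ → ℝ} (hφ : ContDiff ℝ 1 φ) :
    Continuous (prodGradient φ) :=
  (LinearIsometryEquiv.continuous _).comp
    ((hφ.continuous_fderiv one_ne_zero).clm_comp continuous_const)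

theorem measurable_enorm_prodGradient_sq [MeasurableSpace E] [BorelSpace E] {φ : E × ℝ → ℝ}
    (hφ : ContDiff ℝ 1 φ) :
    Measurable fun z => ‖prodGradient φ z‖ₑ ^ 2 :=
  (continuous_prodGradient hφ).enorm.measurable.pow_const 2

theorem enorm_fderiv_le (φ : E × ℝ → ℝ) (z w : E × ℝ) :
    ‖fderiv ℝ φ z w‖ₑ ≤ ‖WithLp.toLp 2 w‖ₑ * ‖prodGradient φ z‖ₑ := by
  have cauchy_schwarz := norm_inner_le_norm (𝕜 := ℝ) (prodGradient φ z) (WithLp.toLp 2 w)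
  rw [inner_prodGradient, mul_comm] at cauchy_schwarz
  rw [← enorm_norm (WithLp.toLp 2 w), ← enorm_norm (prodGradient φ z), ← enorm_mul,
    enorm_le_iff_norm_le, norm_mul, norm_norm, norm_norm]
  exact cauchy_schwarz

theorem enorm_fderiv_vertical_le (φ : E × ℝ → ℝ) (z : E × ℝ) :
    ‖fderiv ℝ φ z (0, 1)‖ₑ ≤ ‖prodGradient φ z‖ₑ := by
  refine (enorm_fderiv_le φ z (0, 1)).trans_eq ?_
  rw [← ofReal_norm, WithLp.norm_toLp_snd, norm_one, ENNReal.ofReal_one, one_mul]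

theorem enorm_fderiv_horizontal_le (φ : E × ℝ → ℝ) (z : E × ℝ) (a : E) :
    ‖fderiv ℝ φ z (a, 0)‖ₑ ≤ ‖a‖ₑ * ‖prodGradient φ z‖ₑ := by
  refine (enorm_fderiv_le φ z (a, 0)).trans_eq ?_
  rw [← ofReal_norm, WithLp.norm_toLp_fst, ofReal_norm]

end Gradient

section SliceIntegral

variable {X Y : Type*} [MeasurableSpace X] [MeasureSpace Y]

/-- The integral of `F` over the slice of `Ω` above `x`. -/
noncomputable def sliceIntegral (Ω : Set (X × Y)) (F : X × Y → ℝ≥0∞) (x : X) : ℝ≥0∞ :=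
  ∫⁻ y, Ω.indicator F (x, y)

variable [SFinite (volume : Measure Y)] {Ω : Set (X × Y)} {F : X × Y → ℝ≥0∞}

theorem measurable_sliceIntegral (hΩ : MeasurableSet Ω) (hF : Measurable F) :
    Measurable (sliceIntegral Ω F) :=
  (hF.indicator hΩ).lintegral_prod_right'

theorem lintegral_sliceIntegral (hΩ : MeasurableSet Ω) (hF : Measurable F) (μ : Measure X) :
    ∫⁻ x, sliceIntegral Ω F x ∂μ = ∫⁻ z in Ω, F z ∂(μ.prod volume) := by
  rw [← lintegral_indicator hΩ, lintegral_prod _ (hF.indicator hΩ).aemeasurable]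
  rfl

end SliceIntegral

section SegmentAverage

variable {E : Type*} [NormedAddCommGroup E] [NormedSpace ℝ E]

/-- The average of `Γ` over the segment from `x` to `x + a`. -/
noncomputable def segmentAverage (Γ : E → ℝ≥0∞) (x a : E) : ℝ≥0∞ :=
  ∫⁻ σ in Ioo (0 : ℝ) 1, Γ (x + σ • a)

variable [MeasurableSpace E] [BorelSpace E] [SecondCountableTopology E] {Γ : E → ℝ≥0∞}

theorem measurable_segmentAverage {X : Type*} [MeasurableSpace X] {f g : X → E}
    (hΓ : Measurable Γ) (hf : Measurable f) (hg : Measurable g) :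
    Measurable fun x => segmentAverage Γ (f x) (g x) := by
  have h : Measurable fun q : X × ℝ => Γ (f q.1 + q.2 • g q.1) := by fun_prop
  exact h.lintegral_prod_right'

theorem lintegral_segmentAverage (μ : Measure E) [SFinite μ] [μ.IsAddRightInvariant]
    (hΓ : Measurable Γ) (c a : E) :
    ∫⁻ x, segmentAverage Γ (x + c) a ∂μ = ∫⁻ x, Γ x ∂μ := by
  have hm : Measurable fun q : E × ℝ => Γ (q.1 + c + q.2 • a) := by fun_prop
  simp only [segmentAverage]
  rw [lintegral_lintegral_swap hm.aemeasurable]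
  simp only [add_assoc, lintegral_add_right_eq_self Γ, setLIntegral_const, Real.volume_Ioo,
    sub_zero, ENNReal.ofReal_one, mul_one]

end SegmentAverage

section LineDerivatives

variable {E : Type*} [NormedAddCommGroup E] [NormedSpace ℝ E] {φ : E × ℝ → ℝ}

theorem hasDerivAt_vertical (hφ : Differentiable ℝ φ) (x : E) (t : ℝ) :
    HasDerivAt (fun t => φ (x, t)) (fderiv ℝ φ (x, t) (0, 1)) t :=
  (hφ (x, t)).hasFDerivAt.comp_hasDerivAt t ((hasDerivAt_const t x).prodMk (hasDerivAt_id t))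

theorem hasDerivAt_horizontal (hφ : Differentiable ℝ φ) (x a : E) (θ σ : ℝ) :
    HasDerivAt (fun σ : ℝ => φ (x + σ • a, θ)) (fderiv ℝ φ (x + σ • a, θ) (a, 0)) σ := by
  have segment : HasDerivAt (fun σ : ℝ => x + σ • a) a σ := by
    simpa using ((hasDerivAt_id σ).smul_const a).const_add x
  exact (hφ _).hasFDerivAt.comp_hasDerivAt σ (segment.prodMk (hasDerivAt_const σ θ))

end LineDerivatives

section Energy

variable {E : Type*} [NormedAddCommGroup E] [InnerProductSpace ℝ E] [CompleteSpace E]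
  {Ω : Set (E × ℝ)} {φ : E × ℝ → ℝ}

/-- The Dirichlet energy density of `φ` integrated over the slice of `Ω` above each point of `E`. -/
noncomputable def sliceEnergy (Ω : Set (E × ℝ)) (φ : E × ℝ → ℝ) : E → ℝ≥0∞ :=
  sliceIntegral Ω fun z => ‖prodGradient φ z‖ₑ ^ 2

theorem enorm_horizontal_sub_sq_le (hφ : ContDiff ℝ 1 φ) {x a : E} {θ : ℝ}
    (h : ∀ σ ∈ Ioo (0 : ℝ) 1, (x + σ • a, θ) ∈ Ω) :
    ‖φ (x + a, θ) - φ (x, θ)‖ₑ ^ 2 ≤ ‖a‖ₑ ^ 2 * ∫⁻ σ in Ioo (0 : ℝ) 1,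
      Ω.indicator (fun z => ‖prodGradient φ z‖ₑ ^ 2) (x + σ • a, θ) := by
  have hcont : Continuous fun σ : ℝ => fderiv ℝ φ (x + σ • a, θ) (a, 0) :=
    ((hφ.continuous_fderiv one_ne_zero).comp (by fun_prop)).clm_apply continuous_const
  have h1 := enorm_sub_sq_le_lintegral_deriv
    (hasDerivAt_horizontal (hφ.differentiable one_ne_zero) x a θ) hcont zero_le_one
  simp only [one_smul, zero_smul, add_zero, sub_zero, ENNReal.ofReal_one, one_mul] at h1
  refine h1.trans ?_
  rw [← lintegral_const_mul' _ _ (by simp)]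
  refine setLIntegral_mono' measurableSet_Ioo fun σ hσ => ?_
  rw [indicator_of_mem (h σ hσ), ← mul_pow]
  gcongr
  exact enorm_fderiv_horizontal_le φ _ a

theorem enorm_vertical_sub_sq_le (hφ : ContDiff ℝ 1 φ) {x : E} {a b : ℝ} (hab : a ≤ b)
    (h : ∀ t ∈ Ioo a b, (x, t) ∈ Ω) :
    ‖φ (x, b) - φ (x, a)‖ₑ ^ 2 ≤ ENNReal.ofReal (b - a) * sliceEnergy Ω φ x := by
  have hcont : Continuous fun t : ℝ => fderiv ℝ φ (x, t) (0, 1) :=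
    ((hφ.continuous_fderiv one_ne_zero).comp (by fun_prop)).clm_apply continuous_const
  refine (enorm_sub_sq_le_lintegral_deriv
    (hasDerivAt_vertical (hφ.differentiable one_ne_zero) x) hcont hab).trans ?_
  gcongr
  refine (setLIntegral_mono' measurableSet_Ioo fun t ht => ?_).trans (setLIntegral_le_lintegral _ _)
  rw [indicator_of_mem (h t ht)]
  gcongr
  exact enorm_fderiv_vertical_le φ _

variable [MeasurableSpace E] [BorelSpace E]

theorem measurable_sliceEnergy (hΩ : MeasurableSet Ω) (hφ : ContDiff ℝ 1 φ) :
    Measurable (sliceEnergy Ω φ) :=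
  measurable_sliceIntegral hΩ (measurable_enorm_prodGradient_sq hφ)

theorem lintegral_enorm_horizontal_sub_sq_le (hΩ : MeasurableSet Ω) (hφ : ContDiff ℝ 1 φ)
    {x a : E} {S : Set ℝ} (hS : MeasurableSet S)
    (h : ∀ θ ∈ S, ∀ σ ∈ Ioo (0 : ℝ) 1, (x + σ • a, θ) ∈ Ω) :
    ∫⁻ θ in S, ‖φ (x + a, θ) - φ (x, θ)‖ₑ ^ 2
      ≤ ‖a‖ₑ ^ 2 * segmentAverage (sliceEnergy Ω φ) x a := by
  have hm := (measurable_enorm_prodGradient_sq hφ).indicator hΩ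
  calc ∫⁻ θ in S, ‖φ (x + a, θ) - φ (x, θ)‖ₑ ^ 2
      ≤ ∫⁻ θ in S, ‖a‖ₑ ^ 2 * ∫⁻ σ in Ioo (0 : ℝ) 1,
          Ω.indicator (fun z => ‖prodGradient φ z‖ₑ ^ 2) (x + σ • a, θ) :=
        setLIntegral_mono' hS fun θ hθ => enorm_horizontal_sub_sq_le hφ (h θ hθ)
    _ ≤ ∫⁻ θ, ‖a‖ₑ ^ 2 * ∫⁻ σ in Ioo (0 : ℝ) 1,
          Ω.indicator (fun z => ‖prodGradient φ z‖ₑ ^ 2) (x + σ • a, θ) :=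
        setLIntegral_le_lintegral _ _
    _ = ‖a‖ₑ ^ 2 * segmentAverage (sliceEnergy Ω φ) x a := by
      rw [lintegral_const_mul' _ _ (by simp), lintegral_lintegral_swap]
      · rfl
      · exact (hm.comp (by fun_prop)).aemeasurable

theorem lintegral_enorm_detour_sub_sq_le (hΩ : MeasurableSet Ω) (hφ : ContDiff ℝ 1 φ)
    {x y b : E} {S : Set ℝ} (hS : MeasurableSet S)
    (hx : ∀ θ ∈ S, ∀ σ ∈ Ioo (0 : ℝ) 1, (x + σ • b, θ) ∈ Ω)
    (hxy : ∀ θ ∈ S, ∀ σ ∈ Ioo (0 : ℝ) 1, (x + b + σ • (y - x), θ) ∈ Ω)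
    (hy : ∀ θ ∈ S, ∀ σ ∈ Ioo (0 : ℝ) 1, (y + σ • b, θ) ∈ Ω) :
    ∫⁻ θ in S, ‖φ (x, θ) - φ (y, θ)‖ₑ ^ 2 ≤ 3 *
      (‖b‖ₑ ^ 2 * segmentAverage (sliceEnergy Ω φ) x b
        + ‖y - x‖ₑ ^ 2 * segmentAverage (sliceEnergy Ω φ) (x + b) (y - x)
        + ‖b‖ₑ ^ 2 * segmentAverage (sliceEnergy Ω φ) y b) := by
  have hφc := hφ.continuous
  have pointwise (θ : ℝ) : ‖φ (x, θ) - φ (y, θ)‖ₑ ^ 2 ≤ 3 * (‖φ (x + b, θ) - φ (x, θ)‖ₑ ^ 2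
      + ‖φ (x + b + (y - x), θ) - φ (x + b, θ)‖ₑ ^ 2 + ‖φ (y + b, θ) - φ (y, θ)‖ₑ ^ 2) := by
    have endpoint : x + b + (y - x) = y + b := by abel
    have detour : φ (x, θ) - φ (y, θ) = (φ (x, θ) - φ (x + b, θ))
        + (φ (x + b, θ) - φ (x + b + (y - x), θ)) + (φ (y + b, θ) - φ (y, θ)) := by
      rw [endpoint]
      abel
    rw [detour, enorm_sub_rev (φ (x + b, θ)) (φ (x, θ)),
      enorm_sub_rev (φ (x + b + (y - x), θ)) (φ (x + b, θ))]
    exact enorm_add₃_sq_le _ _ _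
  refine (lintegral_mono fun θ => pointwise θ).trans ?_
  rw [lintegral_const_mul _ (by fun_prop), lintegral_add_right _ (by fun_prop),
    lintegral_add_right _ (by fun_prop)]
  gcongr
  exacts [lintegral_enorm_horizontal_sub_sq_le hΩ hφ hS hx,
    lintegral_enorm_horizontal_sub_sq_le hΩ hφ hS hxy,
    lintegral_enorm_horizontal_sub_sq_le hΩ hφ hS hy]

end Energy

section Cones

variable {E : Type*} [NormedAddCommGroup E] [NormedSpace ℝ E] {ω : Set E}

/-- `ω` contains the open truncated cone with apex `x` and axis `v` (with an opening depending on
`‖v‖`), as the union of the balls `ball (x + ε • v) ε`. -/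
def ContainsConeAt (ω : Set E) (v : E) (ρ : ℝ) (x : E) : Prop :=
  ∀ ε ∈ Ioo 0 ρ, ball (x + ε • v) ε ⊆ ω

/-- The interior cone condition: near each point of the closure of `ω`, the points of `ω` are the
apices of cones contained in `ω`, translates of one another. -/
def HasInteriorCones (ω : Set E) : Prop :=
  ∀ p ∈ closure ω, ∃ v, ∃ ρ > 0, ∀ x ∈ ω, dist x p < ρ → ContainsConeAt ω v ρ x

theorem ContainsConeAt.mono {v x : E} {ρ ρ' : ℝ} (h : ContainsConeAt ω v ρ x) (hρ : ρ' ≤ ρ) :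
    ContainsConeAt ω v ρ' x :=
  fun ε hε => h ε ⟨hε.1, hε.2.trans_le hρ⟩

theorem ContainsConeAt.add_smul_mem {v x : E} {ρ ε : ℝ} (h : ContainsConeAt ω v ρ x) (h0 : 0 < ε)
    (hε : ε < ρ) : x + ε • v ∈ ω :=
  h ε ⟨h0, hε⟩ (mem_ball_self h0)

theorem exists_containsConeAt_of_mem (hω : IsOpen ω) {p : E} (hp : p ∈ ω) :
    ∃ v, ∃ ρ > 0, ∀ x ∈ ω, dist x p < ρ → ContainsConeAt ω v ρ x := by
  obtain ⟨R, hR, hRω⟩ := Metric.isOpen_iff.1 hω p hp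
  refine ⟨0, R / 2, half_pos hR, fun x _ hxp ε hε => ?_⟩
  rw [smul_zero, add_zero]
  exact (ball_subset_ball' (by linarith [hε.2])).trans hRω

end Cones

section LipschitzDomain

theorem lipschitz_epigraph_add {E : Type*} [NormedAddCommGroup E] [InnerProductSpace ℝ E] {e : E}
    (he : ‖e‖ = 1) {K : ℝ≥0} {g : E → ℝ} (hg : LipschitzWith K g) {x w : E} {ε : ℝ}
    (hx : g (x - inner ℝ e x • e) < inner ℝ e x) (hw : ‖w‖ ≤ ε) :
    letI y := x + ε • ((K : ℝ) + 1) • e + w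
    g (y - inner ℝ e y • e) < inner ℝ e y := by
  have inner_e_e : inner ℝ e e = (1 : ℝ) := by rw [real_inner_self_eq_norm_sq, he, one_pow]
  have height : inner ℝ e (x + ε • ((K : ℝ) + 1) • e + w)
      = inner ℝ e x + ε * (K + 1) + inner ℝ e w := by
    simp only [inner_add_right, real_inner_smul_right, inner_e_e, mul_one]
  have inner_le : |inner ℝ e w| ≤ ‖w‖ := by simpa [he] using abs_real_inner_le_norm e w
  have norm_proj_le : ‖w - inner ℝ e w • e‖ ≤ ‖w‖ := by
    refine (pow_le_pow_iff_left₀ (norm_nonneg _) (norm_nonneg _) two_ne_zero).1 ?_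
    rw [norm_sub_sq_real, real_inner_smul_right, norm_smul, he, mul_one, Real.norm_eq_abs, sq_abs,
      real_inner_comm]
    nlinarith [sq_nonneg (inner ℝ e w)]
  have base : x + ε • ((K : ℝ) + 1) • e + w - (inner ℝ e x + ε * (K + 1) + inner ℝ e w) • e
      = x - inner ℝ e x • e + (w - inner ℝ e w • e) := by
    module
  have lipschitz : |g (x - inner ℝ e x • e + (w - inner ℝ e w • e)) - g (x - inner ℝ e x • e)|
      ≤ K * ‖w - inner ℝ e w • e‖ := by
    simpa [Real.dist_eq, dist_eq_norm] using
      hg.dist_le_mul (x - inner ℝ e x • e + (w - inner ℝ e w • e)) (x - inner ℝ e x • e)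
  rw [height, base]
  have rise : K * ‖w - inner ℝ e w • e‖ ≤ K * ε :=
    mul_le_mul_of_nonneg_left (norm_proj_le.trans hw) K.2
  linarith [(abs_le.1 inner_le).1, (abs_le.1 lipschitz).2]

variable {d : ℕ}

theorem IsLipschitzDomain.hasInteriorCones {ω : Set (𝔼^d)} (hω : IsLipschitzDomain ω) :
    HasInteriorCones ω := by
  intro p hp
  by_cases hpω : p ∈ ω
  · exact exists_containsConeAt_of_mem hω.isOpen hpω
  obtain ⟨e, he, K, g, hg, r, hr, epigraph⟩ :=
    hω.boundary p ⟨hp, by rwa [hω.isOpen.interior_eq]⟩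
  have hK : (0 : ℝ) < K + 3 := by positivity
  refine ⟨((K : ℝ) + 1) • e, r / (K + 3), div_pos hr hK, fun x hx hxp ε ⟨hε, hερ⟩ y hy => ?_⟩
  rw [lt_div_iff₀ hK] at hxp hερ
  obtain ⟨w, rfl⟩ : ∃ w, y = x + ε • ((K : ℝ) + 1) • e + w := ⟨_, (add_sub_cancel _ y).symm⟩
  have hw : ‖w‖ < ε := by simpa [mem_ball, dist_eq_norm] using hy
  have hxr : x ∈ ball p r := mem_ball.2 (by nlinarith [dist_nonneg (x := x) (y := p), K.2])
  have hyr : x + ε • ((K : ℝ) + 1) • e + w ∈ ball p r := by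
    have norm_axis : ‖ε • ((K : ℝ) + 1) • e‖ = ε * (K + 1) := by
      rw [norm_smul, norm_smul, he, mul_one, Real.norm_of_nonneg hε.le,
        Real.norm_of_nonneg (by positivity)]
    rw [mem_ball, dist_eq_norm, show x + ε • ((K : ℝ) + 1) • e + w - p
      = (x - p) + ε • ((K : ℝ) + 1) • e + w by abel]
    have triangle := norm_add₃_le (a := x - p) (b := ε • ((K : ℝ) + 1) • e) (c := w)
    rw [norm_axis, ← dist_eq_norm] at triangle
    nlinarith
  exact (epigraph _ hyr).2 (lipschitz_epigraph_add he hg ((epigraph x hxr).1 hx) hw.le)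

end LipschitzDomain

section ConeCover

variable {E : Type*} [NormedAddCommGroup E] [NormedSpace ℝ E] {ω : Set E}

theorem HasInteriorCones.exists_finite_cover (h : HasInteriorCones ω)
    (hω : IsCompact (closure ω)) :
    ∃ (t : Finset E) (r : E → ℝ) (v : E → E) (ρ : ℝ), 0 < ρ ∧
      closure ω ⊆ ⋃ p ∈ t, ball p (r p) ∧
      ∀ p ∈ t, ∀ x ∈ ω, dist x p < r p + ρ → ContainsConeAt ω (v p) ρ x := by
  choose! v R hR hcone using h
  obtain ⟨t, htω, ht⟩ := hω.elim_nhds_subcover (fun p => ball p (R p / 2))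
    (fun p hp => ball_mem_nhds p (half_pos (hR p hp)))
  have small_ρ : ∀ᶠ ρ in 𝓝[>] (0 : ℝ), 0 < ρ ∧ ∀ p ∈ t, ρ < R p / 2 :=
    eventually_mem_nhdsWithin.and <| (Finset.eventually_all t).2 fun p hp =>
      eventually_nhdsWithin_of_eventually_nhds (eventually_lt_nhds (half_pos (hR p (htω p hp))))
  obtain ⟨ρ, hρ0, hρ⟩ := small_ρ.exists
  refine ⟨t, fun p => R p / 2, v, ρ, hρ0, ht, fun p hp x hx hxp => ?_⟩
  have := hρ p hp
  exact (hcone p (htω p hp) x hx (by linarith)).mono (by linarith)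

theorem HasInteriorCones.exists_finset_axes (h : HasInteriorCones ω) (hω : IsCompact (closure ω)) :
    ∃ V : Finset E, ∃ ρ > 0, ∀ x ∈ ω, ∀ y ∈ ω, dist y x < ρ →
      ∃ v ∈ V, ContainsConeAt ω v ρ x ∧ ContainsConeAt ω v ρ y := by
  classical
  obtain ⟨t, r, v, ρ, hρ, hcover, hcone⟩ := h.exists_finite_cover hω
  refine ⟨t.image v, ρ, hρ, fun x hx y hy hyx => ?_⟩
  obtain ⟨p, hp, hxp⟩ := mem_iUnion₂.1 (hcover (subset_closure hx))
  have hxp : dist x p < r p := hxp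
  exact ⟨v p, Finset.mem_image_of_mem v hp, hcone p hp x hx (by linarith),
    hcone p hp y hy (by linarith [dist_triangle y x p])⟩

theorem ContainsConeAt.detour_mem {x y v : E} {ρ : ℝ} (hx : ContainsConeAt ω v ρ x)
    (hy : ContainsConeAt ω v ρ y) (hxy : x ≠ y) (hρ : 2 * ‖y - x‖ < ρ) {σ : ℝ}
    (hσ : σ ∈ Ioo (0 : ℝ) 1) :
    letI b := (2 * ‖y - x‖) • v
    x + σ • b ∈ ω ∧ x + b + σ • (y - x) ∈ ω ∧ y + σ • b ∈ ω := by
  have hr : 0 < ‖y - x‖ := norm_sub_pos_iff.2 hxy.symm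
  have ε_lt : σ * (2 * ‖y - x‖) < ρ := by nlinarith [hσ.2]
  have ε_pos : 0 < σ * (2 * ‖y - x‖) := mul_pos hσ.1 (by positivity)
  simp only [smul_smul σ]
  refine ⟨hx.add_smul_mem ε_pos ε_lt, hx (2 * ‖y - x‖) ⟨by positivity, hρ⟩ ?_,
    hy.add_smul_mem ε_pos ε_lt⟩
  rw [mem_ball, dist_eq_norm, add_sub_cancel_left, norm_smul, Real.norm_of_nonneg hσ.1.le]
  nlinarith [hσ.2]

theorem norm_detour_sub_le (x y v : E) {σ : ℝ} (hσ : σ ∈ Ioo (0 : ℝ) 1) :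
    letI b := (2 * ‖y - x‖) • v
    letI R := (2 * ‖v‖ + 1) * ‖y - x‖
    ‖x + σ • b - x‖ ≤ R ∧ ‖x + b + σ • (y - x) - x‖ ≤ R ∧ ‖y + σ • b - x‖ ≤ R := by
  have norm_b : ‖(2 * ‖y - x‖) • v‖ = 2 * ‖v‖ * ‖y - x‖ := by
    rw [norm_smul, Real.norm_of_nonneg (by positivity)]
    ring
  have norm_smul_le (a : E) : ‖σ • a‖ ≤ ‖a‖ := by
    rw [norm_smul, Real.norm_of_nonneg hσ.1.le]
    exact mul_le_of_le_one_left (norm_nonneg a) hσ.2.le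
  have h₁ := norm_smul_le ((2 * ‖y - x‖) • v)
  have h₂ := norm_smul_le (y - x)
  rw [norm_b] at h₁
  refine ⟨?_, ?_, ?_⟩
  · rw [add_sub_cancel_left]
    linarith [norm_nonneg (y - x)]
  · rw [add_assoc, add_sub_cancel_left]
    linarith [norm_add_le ((2 * ‖y - x‖) • v) (σ • (y - x))]
  · rw [show y + σ • ((2 * ‖y - x‖) • v) - x = σ • ((2 * ‖y - x‖) • v) + (y - x) by abel]
    linarith [norm_add_le (σ • ((2 * ‖y - x‖) • v)) (y - x)]

end ConeCover

section SubgraphDomain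

variable {d : ℕ}

variable {ω : Set (𝔼^d)} {η : 𝔼^d → ℝ}

theorem isOpen_subgraphDomain (hω : IsOpen ω) (hη : ContinuousOn η ω) :
    IsOpen (subgraphDomain ω η) := by
  have hdiff : ContinuousOn (fun z : 𝔼^d × ℝ => η z.1 - z.2) (Prod.fst ⁻¹' ω) :=
    (hη.comp continuousOn_fst fun z hz => hz).sub continuousOn_snd
  have below_graph := hdiff.isOpen_inter_preimage (hω.preimage continuous_fst) (isOpen_Ioi (a := 0))
  convert below_graph.inter (isOpen_Ioi.preimage continuous_snd (t := Ioi (0 : ℝ))) using 1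
  ext z
  simp only [subgraphDomain, mem_ofPred_eq, mem_inter_iff, mem_preimage, mem_Ioi, sub_pos]
  tauto

theorem isBounded_subgraphDomain (hω : Bornology.IsBounded ω) (hη : BddAbove (η '' ω)) :
    Bornology.IsBounded (subgraphDomain ω η) := by
  obtain ⟨M, hM⟩ := hη
  exact (hω.prod (isBounded_Icc 0 M)).subset fun z hz =>
    ⟨hz.1, hz.2.1.le, hz.2.2.le.trans (hM ⟨z.1, hz.1, rfl⟩)⟩

end SubgraphDomain

section DetourMajorant

variable {E : Type*} [NormedAddCommGroup E] [NormedSpace ℝ E]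

/-- The sum of the averages of `Γ` along the detour
`x → x + 2‖h‖ • v → x + h + 2‖h‖ • v → x + h` and of its values at both ends; for `Γ` the slice
energy of `φ` it dominates the increment of the trace of `φ` from `x` to `x + h`. -/
noncomputable def detourMajorant (Γ : E → ℝ≥0∞) (v x h : E) : ℝ≥0∞ :=
  Γ x + segmentAverage Γ x ((2 * ‖h‖) • v) + segmentAverage Γ (x + (2 * ‖h‖) • v) h
    + segmentAverage Γ (x + h) ((2 * ‖h‖) • v) + Γ (x + h)

variable [MeasurableSpace E] [BorelSpace E] [SecondCountableTopology E] {Γ : E → ℝ≥0∞}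

theorem measurable_detourMajorant (hΓ : Measurable Γ) (v : E) :
    Measurable fun p : E × E => detourMajorant Γ v p.1 p.2 := by
  have h₁ := measurable_segmentAverage hΓ (f := fun p : E × E => p.1)
    (g := fun p => (2 * ‖p.2‖) • v) (by fun_prop) (by fun_prop)
  have h₂ := measurable_segmentAverage hΓ (f := fun p : E × E => p.1 + (2 * ‖p.2‖) • v)
    (g := fun p => p.2) (by fun_prop) (by fun_prop)
  have h₃ := measurable_segmentAverage hΓ (f := fun p : E × E => p.1 + p.2)
    (g := fun p => (2 * ‖p.2‖) • v) (by fun_prop) (by fun_prop)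
  unfold detourMajorant
  fun_prop

theorem lintegral_detourMajorant (μ : Measure E) [SFinite μ] [μ.IsAddRightInvariant]
    (hΓ : Measurable Γ) (v h : E) :
    ∫⁻ x, detourMajorant Γ v x h ∂μ = 5 * ∫⁻ x, Γ x ∂μ := by
  have hmeas (c a : E) : Measurable fun x => segmentAverage Γ (x + c) a :=
    measurable_segmentAverage hΓ (by fun_prop) measurable_const
  have h₀ := hmeas 0 ((2 * ‖h‖) • v)
  have hI := lintegral_segmentAverage μ hΓ 0 ((2 * ‖h‖) • v)
  simp only [add_zero] at h₀ hI
  simp only [detourMajorant]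
  rw [lintegral_add_right _ (by fun_prop), lintegral_add_right _ (hmeas _ _),
    lintegral_add_right _ (hmeas _ _), lintegral_add_right _ h₀, hI,
    lintegral_segmentAverage μ hΓ, lintegral_segmentAverage μ hΓ, lintegral_add_right_eq_self Γ]
  ring

end DetourMajorant

section TraceIncrements

variable {d : ℕ}

variable {ω : Set (𝔼^d)} {η : 𝔼^d → ℝ} {φ : 𝔼^d × ℝ → ℝ} {x : 𝔼^d}

theorem lintegral_enorm_graphTrace_sub_sq_le (hφ : ContDiff ℝ 1 φ) (hx : x ∈ ω) {a b L : ℝ}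
    (ha : 0 ≤ a) (hb : b ≤ η x) (hL : η x - a ≤ L) :
    ∫⁻ θ in Ioo a b, ‖graphTrace η φ x - φ (x, θ)‖ₑ ^ 2
      ≤ ENNReal.ofReal (b - a) * (ENNReal.ofReal L * sliceEnergy (subgraphDomain ω η) φ x) := by
  have pointwise : ∀ θ ∈ Ioo a b, ‖graphTrace η φ x - φ (x, θ)‖ₑ ^ 2
      ≤ ENNReal.ofReal L * sliceEnergy (subgraphDomain ω η) φ x := fun θ hθ =>
    (enorm_vertical_sub_sq_le (Ω := subgraphDomain ω η) hφ (hθ.2.le.trans hb) fun t ht =>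
      ⟨hx, (ha.trans_lt hθ.1).trans ht.1, ht.2⟩).trans (by gcongr; linarith [hθ.1])
  refine (setLIntegral_mono' measurableSet_Ioo pointwise).trans_eq ?_
  rw [setLIntegral_const, Real.volume_Ioo, mul_comm]

theorem ofReal_mul_enorm_graphTrace_sq_le (hφ : ContDiff ℝ 1 φ) (hx : x ∈ ω) {m M : ℝ}
    (hm : m ≤ η x) (hM : η x ≤ M) :
    ENNReal.ofReal m * ‖graphTrace η φ x‖ₑ ^ 2
      ≤ 2 * (sliceIntegral (subgraphDomain ω η) (fun z => ‖φ z‖ₑ ^ 2) x + ENNReal.ofReal m *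
        (ENNReal.ofReal M * sliceEnergy (subgraphDomain ω η) φ x)) := by
  have hmeas : Measurable fun θ => ‖φ (x, θ)‖ₑ ^ 2 :=
    (hφ.continuous.comp (Continuous.prodMk_right x)).enorm.measurable.pow_const 2
  have slice : ∫⁻ θ in Ioo 0 m, ‖φ (x, θ)‖ₑ ^ 2
      ≤ sliceIntegral (subgraphDomain ω η) (fun z => ‖φ z‖ₑ ^ 2) x := by
    refine (setLIntegral_mono' measurableSet_Ioo fun θ hθ => ?_).trans
      (setLIntegral_le_lintegral _ _)
    have mem : (x, θ) ∈ subgraphDomain ω η := ⟨hx, hθ.1, hθ.2.trans_le hm⟩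
    rw [indicator_of_mem mem]
  have vertical := lintegral_enorm_graphTrace_sub_sq_le hφ hx le_rfl hm (L := M) (by linarith)
  rw [sub_zero] at vertical
  calc ENNReal.ofReal m * ‖graphTrace η φ x‖ₑ ^ 2
      = ∫⁻ θ in Ioo 0 m, ‖φ (x, θ) + (graphTrace η φ x - φ (x, θ))‖ₑ ^ 2 := by
        simp only [add_sub_cancel, setLIntegral_const, Real.volume_Ioo, sub_zero, mul_comm]
    _ ≤ ∫⁻ θ in Ioo 0 m, 2 * (‖φ (x, θ)‖ₑ ^ 2 + ‖graphTrace η φ x - φ (x, θ)‖ₑ ^ 2) :=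
        lintegral_mono fun θ => enorm_add_sq_le (φ (x, θ)) _
    _ ≤ _ := by
      rw [lintegral_const_mul' _ _ (by simp), lintegral_add_left hmeas]
      gcongr

theorem ofReal_mul_enorm_graphTrace_sub_sq_le (hΩ : MeasurableSet (subgraphDomain ω η))
    (hφ : ContDiff ℝ 1 φ) {y v : 𝔼^d} {ρ l : ℝ} (hx : x ∈ ω) (hy : y ∈ ω)
    (hvx : ContainsConeAt ω v ρ x) (hvy : ContainsConeAt ω v ρ y) (hxy : x ≠ y)
    (hρ : 2 * ‖y - x‖ < ρ) (hl : 2 * l ≤ η x)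
    (hosc : ∀ w ∈ ω, ‖w - x‖ ≤ (2 * ‖v‖ + 1) * ‖y - x‖ → |η w - η x| ≤ l) :
    letI b := (2 * ‖y - x‖) • v
    letI Γ := sliceEnergy (subgraphDomain ω η) φ
    ENNReal.ofReal l * ‖graphTrace η φ x - graphTrace η φ y‖ₑ ^ 2
      ≤ 3 * (ENNReal.ofReal l * (ENNReal.ofReal (2 * l) * Γ x)
        + 3 * (‖b‖ₑ ^ 2 * segmentAverage Γ x b
          + ‖y - x‖ₑ ^ 2 * segmentAverage Γ (x + b) (y - x) + ‖b‖ₑ ^ 2 * segmentAverage Γ y b)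
        + ENNReal.ofReal l * (ENNReal.ofReal (3 * l) * Γ y)) := by
  have hφc := hφ.continuous
  have hmeas (w : 𝔼^d) (c : ℝ) : Measurable fun θ => ‖c - φ (w, θ)‖ₑ ^ 2 :=
    (by fun_prop : Continuous fun θ => c - φ (w, θ)).enorm.measurable.pow_const 2
  have hyx := abs_le.1 <| hosc y hy <|
    le_mul_of_one_le_left (norm_nonneg _) (by linarith [norm_nonneg v])
  have width : η x - l - (η x - 2 * l) = l := by ring
  set S := Ioo (η x - 2 * l) (η x - l)
  have mem_subgraph {w : 𝔼^d} {θ : ℝ} (hθ : θ ∈ S) (hw : w ∈ ω)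
      (hwx : ‖w - x‖ ≤ (2 * ‖v‖ + 1) * ‖y - x‖) : (w, θ) ∈ subgraphDomain ω η :=
    ⟨hw, by linarith [hθ.1], hθ.2.trans_le (by linarith [(abs_le.1 (hosc w hw hwx)).1])⟩
  have detour := lintegral_enorm_detour_sub_sq_le hΩ hφ (S := S) measurableSet_Ioo
    (fun θ hθ σ hσ => mem_subgraph hθ (hvx.detour_mem hvy hxy hρ hσ).1
      (norm_detour_sub_le x y v hσ).1)
    (fun θ hθ σ hσ => mem_subgraph hθ (hvx.detour_mem hvy hxy hρ hσ).2.1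
      (norm_detour_sub_le x y v hσ).2.1)
    (fun θ hθ σ hσ => mem_subgraph hθ (hvx.detour_mem hvy hxy hρ hσ).2.2
      (norm_detour_sub_le x y v hσ).2.2)
  have vertical_x := lintegral_enorm_graphTrace_sub_sq_le hφ hx (a := η x - 2 * l) (b := η x - l)
    (L := 2 * l) (by linarith) (by linarith) (by linarith)
  have vertical_y := lintegral_enorm_graphTrace_sub_sq_le hφ hy (a := η x - 2 * l) (b := η x - l)
    (L := 3 * l) (by linarith) (by linarith) (by linarith)
  rw [width] at vertical_x vertical_y
  calc ENNReal.ofReal l * ‖graphTrace η φ x - graphTrace η φ y‖ₑ ^ 2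
      = ∫⁻ θ in S, ‖(graphTrace η φ x - φ (x, θ)) + (φ (x, θ) - φ (y, θ))
          + -(graphTrace η φ y - φ (y, θ))‖ₑ ^ 2 := by
        simp only [sub_add_sub_cancel, neg_sub, setLIntegral_const, S, Real.volume_Ioo, width]
        rw [mul_comm]
    _ ≤ ∫⁻ θ in S, 3 * (‖graphTrace η φ x - φ (x, θ)‖ₑ ^ 2 + ‖φ (x, θ) - φ (y, θ)‖ₑ ^ 2
          + ‖graphTrace η φ y - φ (y, θ)‖ₑ ^ 2) := by
        refine lintegral_mono fun θ => (enorm_add₃_sq_le (F := ℝ) _ _ _).trans_eq ?_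
        rw [enorm_neg]
    _ ≤ _ := by
      rw [lintegral_const_mul' _ _ (by simp), lintegral_add_right _ (hmeas _ _),
        lintegral_add_left (hmeas _ _)]
      gcongr

theorem enorm_graphTrace_sub_sq_le_detourMajorant (hΩ : MeasurableSet (subgraphDomain ω η))
    (hφ : ContDiff ℝ 1 φ) {y v : 𝔼^d} {ρ l : ℝ} (hx : x ∈ ω) (hy : y ∈ ω)
    (hvx : ContainsConeAt ω v ρ x) (hvy : ContainsConeAt ω v ρ y) (hρ : 2 * ‖y - x‖ < ρ)
    (hvl : (2 * ‖v‖ + 1) * ‖y - x‖ ≤ l) (hl : 2 * l ≤ η x)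
    (hosc : ∀ w ∈ ω, ‖w - x‖ ≤ (2 * ‖v‖ + 1) * ‖y - x‖ → |η w - η x| ≤ l) :
    ‖graphTrace η φ x - graphTrace η φ y‖ₑ ^ 2
      ≤ ENNReal.ofReal (9 * l)
        * detourMajorant (sliceEnergy (subgraphDomain ω η) φ) v x (y - x) := by
  rcases eq_or_ne x y with rfl | hxy
  · simp
  have hr : 0 < ‖y - x‖ := norm_sub_pos_iff.2 hxy.symm
  have hl0 : 0 < l := lt_of_lt_of_le (by positivity) hvl
  have main := ofReal_mul_enorm_graphTrace_sub_sq_le hΩ hφ hx hy hvx hvy hxy hρ hl hosc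
  set Γ := sliceEnergy (subgraphDomain ω η) φ
  have norm_step_le : ‖y - x‖ₑ ≤ ENNReal.ofReal l := by
    rw [← ofReal_norm]
    exact ENNReal.ofReal_le_ofReal (by nlinarith [norm_nonneg v])
  have norm_axis_le : ‖(2 * ‖y - x‖) • v‖ₑ ≤ ENNReal.ofReal l := by
    rw [← ofReal_norm, norm_smul, Real.norm_of_nonneg (by positivity)]
    exact ENNReal.ofReal_le_ofReal (by nlinarith)
  set a := ENNReal.ofReal l
  have ha0 : a ≠ 0 := (ENNReal.ofReal_pos.2 hl0).ne'
  have ha : a ≠ ∞ := ENNReal.ofReal_ne_top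
  have ofReal_mul_l (k : ℝ) (hk : 0 ≤ k) : ENNReal.ofReal (k * l) = ENNReal.ofReal k * a :=
    ENNReal.ofReal_mul hk
  refine (ENNReal.mul_le_mul_iff_right ha0 ha).1 (main.trans ?_)
  rw [ofReal_mul_l 2 zero_le_two, ofReal_mul_l 3 zero_le_three, ofReal_mul_l 9 (by norm_num),
    detourMajorant, add_sub_cancel]
  simp only [ENNReal.ofReal_ofNat]
  set b := (2 * ‖y - x‖) • v
  calc 3 * (a * (2 * a * Γ x) + 3 * (‖b‖ₑ ^ 2 * segmentAverage Γ x b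
          + ‖y - x‖ₑ ^ 2 * segmentAverage Γ (x + b) (y - x) + ‖b‖ₑ ^ 2 * segmentAverage Γ y b)
        + a * (3 * a * Γ y))
      ≤ 3 * (a * (3 * a * Γ x) + 3 * (a ^ 2 * segmentAverage Γ x b
          + a ^ 2 * segmentAverage Γ (x + b) (y - x) + a ^ 2 * segmentAverage Γ y b)
        + a * (3 * a * Γ y)) := by
        gcongr
        norm_num
    _ = _ := by ring

end TraceIncrements

section Slobodeckij

section TruncatedPower

variable {E : Type*} [NormedAddCommGroup E]

/-- The singular kernel `‖h‖ ^ p` (with `p` negative), cut off outside the ball of radius `r`. -/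
noncomputable def truncatedPower (p r : ℝ) : E → ℝ≥0∞ :=
  (ball 0 r).indicator fun h => ENNReal.ofReal (‖h‖ ^ p)

variable [MeasurableSpace E] [BorelSpace E]

theorem measurable_truncatedPower (p r : ℝ) : Measurable (truncatedPower p r : E → ℝ≥0∞) :=
  (ENNReal.measurable_ofReal.comp (measurable_norm.pow_const _)).indicator measurableSet_ball

theorem lintegral_truncatedPower_lt_top [NormedSpace ℝ E] [FiniteDimensional ℝ E]
    (μ : Measure E) [μ.IsAddHaarMeasure] {p : ℝ} (hp : 0 < p + Module.finrank ℝ E) (r : ℝ) :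
    ∫⁻ h, truncatedPower p r h ∂μ < ∞ := by
  rcases subsingleton_or_nontrivial E with hE | hE
  · rw [Module.finrank_zero_of_subsingleton, Nat.cast_zero, add_zero] at hp
    have vanish (h : E) : truncatedPower p r h = 0 := by
      simp [truncatedPower, Subsingleton.elim h 0, Real.zero_rpow hp.ne']
    simp only [vanish, lintegral_zero, ENNReal.zero_lt_top]
  · have integrable : IntegrableOn (fun h : E => ‖h‖ ^ p) (ball 0 r) μ := by
      refine integrableOn_ball_of_norm_le_rpow (C := 1) (α := -p) Module.finrank_pos (by linarith)
        (Eventually.of_forall fun h => ?_) (measurable_norm.pow_const _).aestronglyMeasurable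
      rw [Real.norm_of_nonneg (by positivity), one_mul, neg_neg]
    rw [truncatedPower, lintegral_indicator measurableSet_ball]
    exact integrable.lintegral_lt_top

end TruncatedPower

theorem lintegral_lintegral_mul_comp_sub_le {G : Type*} [AddGroup G] [MeasurableSpace G]
    [MeasurableAdd G] (μ : Measure G) [SFinite μ] [μ.IsAddRightInvariant] {k : G → ℝ≥0∞}
    {Q : G → G → ℝ≥0∞} {D : ℝ≥0∞} (hk : Measurable k) (hQ : Measurable fun p : G × G => Q p.1 p.2)
    (hD : ∀ h, ∫⁻ x, Q x h ∂μ ≤ D) :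
    ∫⁻ x, ∫⁻ y, k (y - x) * Q x (y - x) ∂μ ∂μ ≤ (∫⁻ h, k h ∂μ) * D := by
  have hQh (h : G) : Measurable fun x => Q x h := by fun_prop
  calc ∫⁻ x, ∫⁻ y, k (y - x) * Q x (y - x) ∂μ ∂μ
      = ∫⁻ x, ∫⁻ h, k h * Q x h ∂μ ∂μ :=
        lintegral_congr fun x => lintegral_sub_right_eq_self (fun h => k h * Q x h) x
    _ = ∫⁻ h, k h * ∫⁻ x, Q x h ∂μ ∂μ := by
        rw [lintegral_lintegral_swap (Measurable.aemeasurable (by fun_prop))]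
        exact lintegral_congr fun h => lintegral_const_mul _ (hQh h)
    _ ≤ ∫⁻ h, k h * D ∂μ := by
        gcongr with h
        exact hD h
    _ = (∫⁻ h, k h ∂μ) * D := lintegral_mul_const _ hk

variable {d : ℕ} {ω : Set (𝔼^d)} {s : ℝ} {g : 𝔼^d → ℝ}

theorem enorm_slobodeckijQuotient_sq (hs : s ≠ 0) (g : 𝔼^d → ℝ) (x y : 𝔼^d) :
    ‖slobodeckijQuotient s g (x, y)‖ₑ ^ 2
      = ‖g x - g y‖ₑ ^ 2 * ENNReal.ofReal (‖y - x‖ ^ (-(d + 2 * s))) := by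
  have hr : 0 ≤ ‖y - x‖ := norm_nonneg _
  have exponent : ((d : ℝ) / 2 + s) * (2 : ℕ) = d + 2 * s := by
    push_cast
    ring
  have enorm_sq (a : ℝ) : ‖a‖ₑ ^ 2 = ENNReal.ofReal (a ^ 2) := by
    rw [← enorm_pow, Real.enorm_of_nonneg (sq_nonneg a)]
  rw [slobodeckijQuotient, if_neg hs, norm_sub_rev x y, enorm_sq, enorm_sq,
    div_pow, div_eq_mul_inv, ENNReal.ofReal_mul (sq_nonneg _), Real.rpow_neg hr,
    ← Real.rpow_natCast (_ ^ _) 2, ← Real.rpow_mul hr, exponent]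

theorem enorm_slobodeckijQuotient_sq_le (hs : 0 < s) {β r₀ : ℝ} (hr₀ : 0 < r₀)
    {x y : 𝔼^d} {Q : ℝ≥0∞}
    (hQ : ‖y - x‖ < r₀ → ‖g x - g y‖ₑ ^ 2 ≤ ENNReal.ofReal (‖y - x‖ ^ β) * Q) :
    ‖slobodeckijQuotient s g (x, y)‖ₑ ^ 2
      ≤ 2 * ENNReal.ofReal (r₀ ^ (-(d + 2 * s))) * (‖g x‖ₑ ^ 2 + ‖g y‖ₑ ^ 2)
        + truncatedPower (β - (d + 2 * s)) r₀ (y - x) * Q := by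
  rcases eq_or_ne x y with rfl | hxy
  · simp [slobodeckijQuotient]
  have hr : 0 < ‖y - x‖ := norm_sub_pos_iff.2 hxy.symm
  rw [enorm_slobodeckijQuotient_sq hs.ne' g x y]
  rcases lt_or_ge ‖y - x‖ r₀ with near | far
  · refine le_add_of_nonneg_of_le zero_le ((mul_le_mul_left (hQ near) _).trans_eq ?_)
    rw [truncatedPower, indicator_of_mem (mem_ball_zero_iff.2 near), sub_eq_add_neg β,
      Real.rpow_add hr, ENNReal.ofReal_mul (by positivity)]
    ring
  · refine le_add_of_le_of_nonneg ?_ zero_le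
    have hfar : ‖y - x‖ ^ (-(d + 2 * s)) ≤ r₀ ^ (-(d + 2 * s)) :=
      Real.rpow_le_rpow_of_nonpos hr₀ far (neg_nonpos.2 (by positivity))
    calc ‖g x - g y‖ₑ ^ 2 * ENNReal.ofReal (‖y - x‖ ^ (-(d + 2 * s)))
        ≤ 2 * (‖g x‖ₑ ^ 2 + ‖-g y‖ₑ ^ 2) * ENNReal.ofReal (r₀ ^ (-(d + 2 * s))) := by
          rw [sub_eq_add_neg (g x)]
          gcongr
          exact enorm_add_sq_le _ _
      _ = _ := by
          rw [enorm_neg]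
          ring

theorem lintegral_enorm_slobodeckijQuotient_sq_le (hω : MeasurableSet ω) (hω_fin : volume ω ≠ ∞)
    (hs : 0 < s) {β r₀ : ℝ} (hr₀ : 0 < r₀) {Q : 𝔼^d → 𝔼^d → ℝ≥0∞} {D : ℝ≥0∞}
    (hQm : Measurable fun p : 𝔼^d × 𝔼^d => Q p.1 p.2) (hQD : ∀ h, ∫⁻ x, Q x h ≤ D)
    (hQ : ∀ x ∈ ω, ∀ y ∈ ω, ‖y - x‖ < r₀ →
      ‖g x - g y‖ₑ ^ 2 ≤ ENNReal.ofReal (‖y - x‖ ^ β) * Q x (y - x)) :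
    ∫⁻ p, ‖slobodeckijQuotient s g p‖ₑ ^ 2 ∂((volume.restrict ω).prod (volume.restrict ω))
      ≤ 4 * ENNReal.ofReal (r₀ ^ (-(d + 2 * s))) * volume ω * (∫⁻ x in ω, ‖g x‖ₑ ^ 2)
        + (∫⁻ h : 𝔼^d, truncatedPower (β - (d + 2 * s)) r₀ h) * D := by
  set A := 2 * ENNReal.ofReal (r₀ ^ (-(d + 2 * s)))
  have hA : A ≠ ∞ := by finiteness
  set k : 𝔼^d → ℝ≥0∞ := truncatedPower (β - (d + 2 * s)) r₀
  have hk : Measurable k := measurable_truncatedPower _ _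
  have hkQ : Measurable fun p : 𝔼^d × 𝔼^d => k (p.2 - p.1) * Q p.1 (p.2 - p.1) :=
    (hk.comp (by fun_prop)).mul
      (hQm.comp (f := fun p : 𝔼^d × 𝔼^d => (p.1, p.2 - p.1)) (by fun_prop))
  set I := ∫⁻ x in ω, ‖g x‖ₑ ^ 2
  calc ∫⁻ p, ‖slobodeckijQuotient s g p‖ₑ ^ 2 ∂((volume.restrict ω).prod (volume.restrict ω))
      ≤ ∫⁻ x in ω, ∫⁻ y in ω, ‖slobodeckijQuotient s g (x, y)‖ₑ ^ 2 := lintegral_prod_le _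
    _ ≤ ∫⁻ x in ω, ∫⁻ y in ω, (A * (‖g x‖ₑ ^ 2 + ‖g y‖ₑ ^ 2) + k (y - x) * Q x (y - x)) :=
        setLIntegral_mono' hω fun x hx => setLIntegral_mono' hω fun y hy =>
          enorm_slobodeckijQuotient_sq_le hs hr₀ (hQ x hx y hy)
    _ ≤ ∫⁻ x in ω, (A * (‖g x‖ₑ ^ 2 * volume ω + I) + ∫⁻ y, k (y - x) * Q x (y - x)) := by
        gcongr with x
        rw [lintegral_add_right _ (by fun_prop), lintegral_const_mul' _ _ hA,
          lintegral_add_left measurable_const, setLIntegral_const]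
        gcongr
        exact Measure.restrict_le_self
    _ ≤ A * (I * volume ω + I * volume ω) + (∫⁻ h, k h) * D := by
        rw [lintegral_add_right _ hkQ.lintegral_prod_right', lintegral_const_mul' _ _ hA,
          lintegral_add_right _ measurable_const, setLIntegral_const,
          lintegral_mul_const' _ _ hω_fin]
        gcongr
        exact (lintegral_mono' Measure.restrict_le_self le_rfl).trans
          (lintegral_lintegral_mul_comp_sub_le volume hk hQm hQD)
    _ = _ := by
        simp only [A]
        ring

end Slobodeckij

section TraceInequality

variable {d : ℕ} {ω : Set (𝔼^d)} {η : 𝔼^d → ℝ}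

/-- The squared `H¹(Ω)` norm of the `C¹` function `φ`. -/
noncomputable def sobolevEnergy (Ω : Set (𝔼^d × ℝ)) (φ : 𝔼^d × ℝ → ℝ) : ℝ≥0∞ :=
  (∫⁻ z in Ω, ‖φ z‖ₑ ^ 2) + ∫⁻ z in Ω, ‖prodGradient φ z‖ₑ ^ 2

theorem lintegral_sliceEnergy_le_sobolevEnergy {Ω : Set (𝔼^d × ℝ)} {φ : 𝔼^d × ℝ → ℝ}
    (hΩ : MeasurableSet Ω) (hφ : ContDiff ℝ 1 φ) :
    ∫⁻ x, sliceEnergy Ω φ x ≤ sobolevEnergy Ω φ :=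
  (lintegral_sliceIntegral hΩ (measurable_enorm_prodGradient_sq hφ) volume).trans_le le_add_self

theorem exists_lintegral_graphTrace_sq_le (hω : MeasurableSet ω)
    (hΩ : MeasurableSet (subgraphDomain ω η)) {m M : ℝ} (hm0 : 0 < m) (hm : ∀ x ∈ ω, m ≤ η x)
    (hM : ∀ x ∈ ω, η x ≤ M) :
    ∃ C : ℝ≥0, ∀ φ : 𝔼^d × ℝ → ℝ, ContDiff ℝ 1 φ →
      ∫⁻ x in ω, ‖graphTrace η φ x‖ₑ ^ 2 ≤ C * sobolevEnergy (subgraphDomain ω η) φ := by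
  set a := ENNReal.ofReal m
  have ha0 : a ≠ 0 := (ENNReal.ofReal_pos.2 hm0).ne'
  have ha : a ≠ ∞ := ENNReal.ofReal_ne_top
  set C := 2 * (a⁻¹ + ENNReal.ofReal M)
  have hC : C ≠ ∞ := by finiteness
  refine ⟨C.toNNReal, fun φ hφ => ?_⟩
  rw [ENNReal.coe_toNNReal hC, sobolevEnergy]
  have hF : Measurable fun z => ‖φ z‖ₑ ^ 2 := hφ.continuous.enorm.measurable.pow_const 2
  set X := ∫⁻ z in subgraphDomain ω η, ‖φ z‖ₑ ^ 2
  set Y := ∫⁻ z in subgraphDomain ω η, ‖prodGradient φ z‖ₑ ^ 2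
  refine (ENNReal.mul_le_mul_iff_right ha0 ha).1 ?_
  calc a * ∫⁻ x in ω, ‖graphTrace η φ x‖ₑ ^ 2
      = ∫⁻ x in ω, a * ‖graphTrace η φ x‖ₑ ^ 2 := (lintegral_const_mul' _ _ ha).symm
    _ ≤ ∫⁻ x in ω, 2 * (sliceIntegral (subgraphDomain ω η) (fun z => ‖φ z‖ₑ ^ 2) x
          + a * (ENNReal.ofReal M * sliceEnergy (subgraphDomain ω η) φ x)) :=
        setLIntegral_mono' hω fun x hx =>
          ofReal_mul_enorm_graphTrace_sq_le hφ hx (hm x hx) (hM x hx)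
    _ ≤ ∫⁻ x, 2 * (sliceIntegral (subgraphDomain ω η) (fun z => ‖φ z‖ₑ ^ 2) x
          + a * (ENNReal.ofReal M * sliceEnergy (subgraphDomain ω η) φ x)) :=
        setLIntegral_le_lintegral _ _
    _ = 2 * (X + a * (ENNReal.ofReal M * Y)) := by
      rw [lintegral_const_mul' _ _ (by simp), lintegral_add_left (measurable_sliceIntegral hΩ hF),
        lintegral_const_mul' _ _ ha, lintegral_const_mul' _ _ ENNReal.ofReal_ne_top, sliceEnergy,
        lintegral_sliceIntegral hΩ hF, ← Measure.volume_eq_prod,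
        lintegral_sliceIntegral hΩ (measurable_enorm_prodGradient_sq hφ), ← Measure.volume_eq_prod]
    _ ≤ 2 * ((X + Y) + a * (ENNReal.ofReal M * (X + Y))) := by
      gcongr
      exacts [le_self_add, le_add_self]
    _ = a * (C * (X + Y)) := by
      have expand : a * (C * (X + Y))
          = 2 * (a * a⁻¹ * (X + Y) + a * (ENNReal.ofReal M * (X + Y))) := by
        simp only [C]
        ring
      rw [expand, ENNReal.mul_inv_cancel ha0 ha, one_mul]

theorem isBounded_image_of_holderOnWith {X Y : Type*} [PseudoMetricSpace X] [PseudoMetricSpace Y]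
    {f : X → Y} {t : Set X} {H α : ℝ≥0} (hf : HolderOnWith H α f t) (ht : Bornology.IsBounded t) :
    Bornology.IsBounded (f '' t) :=
  isBounded_iff_ediam_ne_top.2 <| ne_top_of_le_ne_top
    (ENNReal.mul_ne_top ENNReal.coe_ne_top (ENNReal.rpow_ne_top_of_nonneg α.2 ht.ediam_ne_top))
    hf.ediam_image_le

theorem exists_pos_lt_and_mul_rpow_lt {α : ℝ} (hα : 0 < α) (c : ℝ) {ρ m : ℝ} (hρ : 0 < ρ)
    (hm : 0 < m) : ∃ r₀ > 0, r₀ < ρ ∧ c * r₀ ^ α < m := by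
  have limit : Tendsto (fun r : ℝ => c * r ^ α) (𝓝[>] 0) (𝓝 (c * 0 ^ α)) :=
    (((Real.continuous_rpow_const hα.le).tendsto 0).const_mul c).mono_left nhdsWithin_le_nhds
  rw [Real.zero_rpow hα.ne', mul_zero] at limit
  have range : ∀ᶠ r in 𝓝[>] (0 : ℝ), r ∈ Ioo 0 ρ := Ioo_mem_nhdsGT hρ
  obtain ⟨r₀, ⟨hr₀, hr₀ρ⟩, hr₀m⟩ :=
    (range.and (limit.eventually (eventually_lt_nhds hm))).exists
  exact ⟨r₀, hr₀, hr₀ρ, hr₀m⟩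

theorem exists_enorm_graphTrace_sub_sq_le (hω : IsCompact (closure ω))
    (hcone : HasInteriorCones ω) (hΩ : MeasurableSet (subgraphDomain ω η)) {α H : ℝ≥0}
    (hα0 : 0 < α) (hα1 : α ≤ 1) (hη : HolderOnWith H α η ω) {m : ℝ} (hm0 : 0 < m)
    (hm : ∀ x ∈ ω, m ≤ η x) :
    ∃ (V : Finset (𝔼^d)) (c : ℝ), ∃ r₀ > 0, ∀ φ : 𝔼^d × ℝ → ℝ, ContDiff ℝ 1 φ →
      ∀ x ∈ ω, ∀ y ∈ ω, ‖y - x‖ < r₀ → ‖graphTrace η φ x - graphTrace η φ y‖ₑ ^ 2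
        ≤ ENNReal.ofReal (‖y - x‖ ^ (α : ℝ)) * (ENNReal.ofReal c *
          ∑ v ∈ V, detourMajorant (sliceEnergy (subgraphDomain ω η) φ) v x (y - x)) := by
  obtain ⟨V, ρ, hρ, hV⟩ := hcone.exists_finset_axes hω
  obtain ⟨N, hN⟩ : ∃ N : ℝ, ∀ v ∈ V, 2 * ‖v‖ + 1 ≤ N := by
    obtain ⟨N, hN⟩ := (V.finite_toSet.image fun v => 2 * ‖v‖ + 1).bddAbove
    exact ⟨N, fun v hv => hN ⟨v, hv, rfl⟩⟩
  set c := max (H * N ^ (α : ℝ)) N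
  obtain ⟨r₀, hr₀, hr₀ρ, hr₀m⟩ := exists_pos_lt_and_mul_rpow_lt (NNReal.coe_pos.2 hα0) (2 * c)
    (lt_min (half_pos hρ) one_pos) hm0
  rw [lt_min_iff] at hr₀ρ
  refine ⟨V, 9 * c, r₀, hr₀, fun φ hφ x hx y hy hyx => ?_⟩
  obtain ⟨v, hv, hvx, hvy⟩ := hV x hx y hy (by rw [dist_eq_norm]; linarith)
  have hN0 : 0 ≤ N := le_trans (by positivity) (hN v hv)
  have hc0 : 0 ≤ c := hN0.trans (le_max_right _ _)
  set r := ‖y - x‖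
  have hr0 : 0 ≤ r := norm_nonneg _
  have r_le_rpow : r ≤ r ^ (α : ℝ) := Real.self_le_rpow_of_le_one hr0 (by linarith) (mod_cast hα1)
  have rpow_le : r ^ (α : ℝ) ≤ r₀ ^ (α : ℝ) := by gcongr
  have bound := enorm_graphTrace_sub_sq_le_detourMajorant (l := c * r ^ (α : ℝ)) hΩ hφ hx hy hvx hvy
    (by linarith)
    (calc (2 * ‖v‖ + 1) * r ≤ N * r ^ (α : ℝ) := by gcongr; exact hN v hv
      _ ≤ c * r ^ (α : ℝ) := by gcongr; exact le_max_right _ _)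
    (by linarith [hm x hx, mul_le_mul_of_nonneg_left rpow_le (mul_nonneg zero_le_two hc0)])
    (fun w hw hwx => by
      have hwx' : dist w x ≤ N * r := by
        rw [dist_eq_norm]
        exact hwx.trans (by gcongr; exact hN v hv)
      have holder := hη.dist_le_of_le hw hx hwx'
      rw [Real.mul_rpow hN0 hr0, ← mul_assoc] at holder
      exact holder.trans (by gcongr; exact le_max_left _ _))
  refine bound.trans ?_
  rw [← mul_assoc, ← mul_assoc, ENNReal.ofReal_mul (by positivity), mul_comm (ENNReal.ofReal _)]
  gcongr
  exact Finset.single_le_sum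
    (f := fun v => detourMajorant (sliceEnergy (subgraphDomain ω η) φ) v x (y - x))
    (fun _ _ => zero_le) hv

theorem exists_lintegral_slobodeckijQuotient_graphTrace_sq_le (hω : IsOpen ω)
    (hω_bdd : Bornology.IsBounded ω) (hcone : HasInteriorCones ω) {α H : ℝ≥0} (hα1 : α ≤ 1)
    (hη : HolderOnWith H α η ω) {m : ℝ} (hm0 : 0 < m) (hm : ∀ x ∈ ω, m ≤ η x) {s : ℝ} (hs0 : 0 ≤ s)
    (hs : s < (α : ℝ) / 2) {C₀ : ℝ≥0} (hC₀ : ∀ φ : 𝔼^d × ℝ → ℝ, ContDiff ℝ 1 φ →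
      ∫⁻ x in ω, ‖graphTrace η φ x‖ₑ ^ 2 ≤ C₀ * sobolevEnergy (subgraphDomain ω η) φ) :
    ∃ C : ℝ≥0, ∀ φ : 𝔼^d × ℝ → ℝ, ContDiff ℝ 1 φ →
      ∫⁻ p, ‖slobodeckijQuotient s (graphTrace η φ) p‖ₑ ^ 2
          ∂((volume.restrict ω).prod (volume.restrict ω))
        ≤ C * sobolevEnergy (subgraphDomain ω η) φ := by
  rcases hs0.eq_or_lt with rfl | hs0
  · exact ⟨0, fun φ _ => by simp [slobodeckijQuotient]⟩
  have hα0 : 0 < α := NNReal.coe_pos.1 (by linarith)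
  have hΩ := (isOpen_subgraphDomain hω (hη.continuousOn hα0)).measurableSet
  obtain ⟨V, c, r₀, hr₀, hV⟩ :=
    exists_enorm_graphTrace_sub_sq_le hω_bdd.isCompact_closure hcone hΩ hα0 hα1 hη hm0 hm
  have hω_fin : volume ω ≠ ∞ := hω_bdd.measure_lt_top.ne
  set A := 4 * ENNReal.ofReal (r₀ ^ (-(d + 2 * s))) * volume ω
  set K := ∫⁻ h : 𝔼^d, truncatedPower (α - (d + 2 * s)) r₀ h
  have hK : K ≠ ∞ := (lintegral_truncatedPower_lt_top volume
    (by rw [finrank_euclideanSpace_fin]; linarith) r₀).ne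
  set C := A * C₀ + K * (ENNReal.ofReal c * (V.card * 5))
  have hC : C ≠ ∞ := by finiteness
  refine ⟨C.toNNReal, fun φ hφ => ?_⟩
  rw [ENNReal.coe_toNNReal hC]
  set Γ := sliceEnergy (subgraphDomain ω η) φ
  have hΓ : Measurable Γ := measurable_sliceEnergy hΩ hφ
  have hmajorant (v : 𝔼^d) := measurable_detourMajorant hΓ v
  have majorant (h : 𝔼^d) : ∫⁻ x, ENNReal.ofReal c * ∑ v ∈ V, detourMajorant Γ v x h
      ≤ ENNReal.ofReal c * (V.card * 5) * sobolevEnergy (subgraphDomain ω η) φ := by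
    rw [lintegral_const_mul' _ _ ENNReal.ofReal_ne_top,
      lintegral_finsetSum _ fun v _ => by fun_prop]
    simp only [lintegral_detourMajorant volume hΓ, Finset.sum_const, nsmul_eq_mul, mul_assoc]
    gcongr
    exact lintegral_sliceEnergy_le_sobolevEnergy hΩ hφ
  refine (lintegral_enorm_slobodeckijQuotient_sq_le hω.measurableSet hω_fin hs0 hr₀ (by fun_prop)
    majorant (hV φ hφ)).trans ?_
  calc A * (∫⁻ x in ω, ‖graphTrace η φ x‖ₑ ^ 2)
        + K * (ENNReal.ofReal c * (V.card * 5) * sobolevEnergy (subgraphDomain ω η) φ)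
      ≤ A * (C₀ * sobolevEnergy (subgraphDomain ω η) φ)
        + K * (ENNReal.ofReal c * (V.card * 5) * sobolevEnergy (subgraphDomain ω η) φ) := by
        gcongr
        exact hC₀ φ hφ
    _ = C * sobolevEnergy (subgraphDomain ω η) φ := by ring

theorem exists_lintegral_graphTrace_sq_add_slobodeckij_le (hω : IsOpen ω)
    (hω_bdd : Bornology.IsBounded ω) (hcone : HasInteriorCones ω) {α H : ℝ≥0} (hα1 : α ≤ 1)
    (hη : HolderOnWith H α η ω) {m : ℝ} (hm0 : 0 < m) (hm : ∀ x ∈ ω, m ≤ η x) {s : ℝ} (hs0 : 0 ≤ s)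
    (hs : s < (α : ℝ) / 2) :
    ∃ C : ℝ≥0, ∀ φ : 𝔼^d × ℝ → ℝ, ContDiff ℝ 1 φ →
      (∫⁻ x in ω, ‖graphTrace η φ x‖ₑ ^ 2)
          + ∫⁻ p, ‖slobodeckijQuotient s (graphTrace η φ) p‖ₑ ^ 2
            ∂((volume.restrict ω).prod (volume.restrict ω))
        ≤ C * sobolevEnergy (subgraphDomain ω η) φ := by
  have hα0 : 0 < α := NNReal.coe_pos.1 (by linarith)
  have hΩ := (isOpen_subgraphDomain hω (hη.continuousOn hα0)).measurableSet
  obtain ⟨M, hM⟩ := (isBounded_image_of_holderOnWith hη hω_bdd).bddAbove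
  obtain ⟨C₁, hC₁⟩ := exists_lintegral_graphTrace_sq_le hω.measurableSet hΩ hm0 hm
    fun x hx => hM ⟨x, hx, rfl⟩
  obtain ⟨C₂, hC₂⟩ := exists_lintegral_slobodeckijQuotient_graphTrace_sq_le hω hω_bdd hcone hα1 hη
    hm0 hm hs0 hs hC₁
  refine ⟨C₁ + C₂, fun φ hφ => ?_⟩
  rw [ENNReal.coe_add, add_mul]
  exact add_le_add (hC₁ φ hφ) (hC₂ φ hφ)

end TraceInequality

section Mollification

theorem sq_eLpNorm_two {X F : Type*} [MeasurableSpace X] [NormedAddCommGroup F]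
    (ν : Measure X) (f : X → F) :
    eLpNorm f 2 ν ^ 2 = ∫⁻ x, ‖f x‖ₑ ^ 2 ∂ν := by
  simpa using eLpNorm_nnreal_pow_eq_lintegral (f := f) (μ := ν) (p := 2) two_ne_zero

variable {V F : Type*} [NormedAddCommGroup V] [MeasurableSpace V] [BorelSpace V]
  [NormedAddCommGroup F]

theorem tendsto_eLpNorm_comp_add_sub {p : ℝ≥0∞} [Fact (1 ≤ p)] (hp : p ≠ ∞) {μ : Measure V}
    [μ.IsAddRightInvariant] [IsLocallyFiniteMeasure μ] [μ.InnerRegularCompactLTTop] {w : V → F}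
    (hw : MemLp w p μ) :
    Tendsto (fun b => eLpNorm (fun z => w (z + b) - w z) p μ) (𝓝 0) (𝓝 0) := by
  let translation : C(V, C(V, V)) := (ContinuousMap.mk (fun q : V × V => q.2 + q.1)).curry
  have preserving : ∀ b, MeasurePreserving (translation b) μ μ := measurePreserving_add_right μ
  have tendsto_translate := Filter.Tendsto.compMeasurePreservingLp
    (tendsto_const_nhds (x := hw.toLp w)) (translation.continuous.tendsto 0) preserving
    (preserving 0) hp
  refine ((Lp.tendsto_Lp_iff_tendsto_eLpNorm' _ _).1 tendsto_translate).congr fun b => ?_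
  refine eLpNorm_congr_ae ?_
  filter_upwards [Lp.coeFn_compMeasurePreserving (hw.toLp w) (preserving b),
    Lp.coeFn_compMeasurePreserving (hw.toLp w) (preserving 0),
    (preserving b).quasiMeasurePreserving.ae hw.coeFn_toLp,
    (preserving 0).quasiMeasurePreserving.ae hw.coeFn_toLp] with z h1 h2 h3 h4
  simp only [Pi.sub_apply, h1, h2, Function.comp_apply, h3, h4]
  simp [translation]

variable [NormedSpace ℝ V] [FiniteDimensional ℝ V] [NormedSpace ℝ F] [CompleteSpace F]
  {μ : Measure V} [μ.IsAddHaarMeasure] {w : V → F}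

theorem lintegral_ofReal_normed (ρ : ContDiffBump (0 : V)) :
    ∫⁻ h, ENNReal.ofReal (ρ.normed μ h) ∂μ = 1 := by
  rw [← ofReal_integral_eq_lintegral_ofReal ρ.integrable_normed
    (Eventually.of_forall ρ.nonneg_normed), ρ.integral_normed, ENNReal.ofReal_one]

theorem enorm_normed_convolution_sub_sq_le (hwm : StronglyMeasurable w)
    (hw : LocallyIntegrable w μ) (ρ : ContDiffBump (0 : V)) (x : V) (y : F) :
    ‖(ρ.normed μ ⋆[lsmul ℝ ℝ, μ] w) x - y‖ₑ ^ 2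
      ≤ ∫⁻ h, ENNReal.ofReal (ρ.normed μ h) * ‖w (x - h) - y‖ₑ ^ 2 ∂μ := by
  set P : Measure V := μ.withDensity fun h => ENNReal.ofReal (ρ.normed μ h) with hP
  have density_measurable := (ρ.continuous_normed (μ := μ)).measurable.ennreal_ofReal
  have P_univ : P univ = 1 := by
    rw [hP, withDensity_apply _ .univ, Measure.restrict_univ, lintegral_ofReal_normed]
  have diff_measurable : StronglyMeasurable fun h => w (x - h) - y :=
    (hwm.comp_measurable (by fun_prop)).sub stronglyMeasurable_const
  have convolution_integrable : Integrable (fun h => ρ.normed μ h • w (x - h)) μ :=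
    (ρ.hasCompactSupport_normed.convolutionExists_left (lsmul ℝ ℝ)
      ρ.continuous_normed hw x).integrable
  have sub_eq_integral : (ρ.normed μ ⋆[lsmul ℝ ℝ, μ] w) x - y
      = ∫ h, ρ.normed μ h • (w (x - h) - y) ∂μ := by
    simp_rw [smul_sub]
    rw [integral_sub convolution_integrable (ρ.integrable_normed.smul_const _), convolution_lsmul,
      integral_smul_const, ρ.integral_normed, one_smul]
  calc ‖(ρ.normed μ ⋆[lsmul ℝ ℝ, μ] w) x - y‖ₑ ^ 2
      ≤ (∫⁻ h, ‖ρ.normed μ h • (w (x - h) - y)‖ₑ ∂μ) ^ 2 := by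
        rw [sub_eq_integral]
        gcongr
        exact enorm_integral_le_lintegral_enorm _
    _ = (∫⁻ h, ‖w (x - h) - y‖ₑ ∂P) ^ 2 := by
        rw [hP, lintegral_withDensity_eq_lintegral_mul _ density_measurable diff_measurable.enorm]
        simp only [enorm_smul, Pi.mul_apply, Real.enorm_of_nonneg (ρ.nonneg_normed _)]
    _ ≤ ∫⁻ h, ‖w (x - h) - y‖ₑ ^ 2 ∂P := by
        simpa only [P_univ, one_mul] using
          sq_lintegral_le_measure_univ_mul P diff_measurable.enorm.aemeasurable
    _ = ∫⁻ h, ENNReal.ofReal (ρ.normed μ h) * ‖w (x - h) - y‖ₑ ^ 2 ∂μ :=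
        lintegral_withDensity_eq_lintegral_mul _ density_measurable
          (diff_measurable.enorm.pow_const 2)

theorem eLpNorm_normed_convolution_comp_add_sub_le (hwm : StronglyMeasurable w)
    (hw : LocallyIntegrable w μ) (ρ : ContDiffBump (0 : V)) {b : V} {κ : ℝ≥0∞}
    (h : ∀ y ∈ ball b ρ.rOut, eLpNorm (fun z => w (z + y) - w z) 2 μ ≤ κ) :
    eLpNorm (fun z => (ρ.normed μ ⋆[lsmul ℝ ℝ, μ] w) (z + b) - w z) 2 μ
      ≤ κ := by
  have weight_measurable : Measurable fun y => ENNReal.ofReal (ρ.normed μ y) :=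
    ρ.continuous_normed.measurable.ennreal_ofReal
  have integrand_measurable : Measurable fun q : V × V =>
      ENNReal.ofReal (ρ.normed μ q.2) * ‖w (q.1 + b - q.2) - w q.1‖ₑ ^ 2 :=
    (weight_measurable.comp measurable_snd).mul (((hwm.comp_measurable (by fun_prop)).sub
      (hwm.comp_measurable measurable_fst)).enorm.pow_const 2)
  have translate_le (y : V) :
      ENNReal.ofReal (ρ.normed μ y) * ∫⁻ z, ‖w (z + b - y) - w z‖ₑ ^ 2 ∂μ
        ≤ ENNReal.ofReal (ρ.normed μ y) * κ ^ 2 := by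
    by_cases hy : y ∈ Function.support (ρ.normed μ)
    · rw [ρ.support_normed_eq, mem_ball_zero_iff] at hy
      simp only [add_sub_assoc]
      rw [← sq_eLpNorm_two]
      gcongr
      exact h _ (by simpa [mem_ball, dist_eq_norm] using hy)
    · rw [Function.notMem_support.1 hy, ENNReal.ofReal_zero, zero_mul, zero_mul]
  rw [← ENNReal.pow_le_pow_left_iff two_ne_zero, sq_eLpNorm_two]
  calc ∫⁻ z, ‖(ρ.normed μ ⋆[lsmul ℝ ℝ, μ] w) (z + b) - w z‖ₑ ^ 2 ∂μ
      ≤ ∫⁻ z, ∫⁻ y, ENNReal.ofReal (ρ.normed μ y) * ‖w (z + b - y) - w z‖ₑ ^ 2 ∂μ ∂μ :=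
        lintegral_mono fun z => enorm_normed_convolution_sub_sq_le hwm hw ρ _ _
    _ = ∫⁻ y, ENNReal.ofReal (ρ.normed μ y) * (∫⁻ z, ‖w (z + b - y) - w z‖ₑ ^ 2 ∂μ) ∂μ := by
        refine (lintegral_lintegral_swap integrand_measurable.aemeasurable).trans ?_
        refine lintegral_congr fun y => lintegral_const_mul _ ?_
        exact ((hwm.comp_measurable (by fun_prop)).sub hwm).enorm.pow_const 2
    _ ≤ ∫⁻ y, ENNReal.ofReal (ρ.normed μ y) * κ ^ 2 ∂μ := lintegral_mono translate_le
    _ = κ ^ 2 := by rw [lintegral_mul_const _ weight_measurable, lintegral_ofReal_normed, one_mul]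

theorem tendsto_eLpNorm_normed_convolution_comp_add_sub (hwm : StronglyMeasurable w)
    (hw : MemLp w 2 μ) {ι : Type*} {l : Filter ι} {ρ : ι → ContDiffBump (0 : V)} {b : ι → V}
    (hρ : Tendsto (fun i => (ρ i).rOut) l (𝓝 0)) (hb : Tendsto b l (𝓝 0)) :
    Tendsto (fun i => eLpNorm (fun z =>
      ((ρ i).normed μ ⋆[lsmul ℝ ℝ, μ] w) (z + b i) - w z) 2 μ) l (𝓝 0) := by
  refine ENNReal.tendsto_nhds_zero.2 fun κ hκ => ?_
  obtain ⟨r, hr, translate_le⟩ := Metric.eventually_nhds_iff.1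
    (ENNReal.tendsto_nhds_zero.1 (tendsto_eLpNorm_comp_add_sub (by simp) hw) κ hκ)
  filter_upwards [hρ.eventually_lt_const (half_pos hr),
    Metric.tendsto_nhds.1 hb _ (half_pos hr)] with i hρi hbi
  refine eLpNorm_normed_convolution_comp_add_sub_le hwm (hw.locallyIntegrable (by norm_num)) _
    fun y hy => translate_le ?_
  have := dist_triangle y (b i) 0
  rw [mem_ball] at hy
  linarith

end Mollification

section WeakGradientMollification

theorem tsupport_normed_sub_subset_closedBall {V : Type*} [NormedAddCommGroup V]
    [NormedSpace ℝ V] [FiniteDimensional ℝ V] [MeasurableSpace V] [BorelSpace V] {μ : Measure V}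
    [μ.IsAddHaarMeasure] (ρ : ContDiffBump (0 : V)) (z : V) :
    tsupport (fun y => ρ.normed μ (z - y)) ⊆ closedBall z ρ.rOut := by
  refine closure_minimal (fun y hy => ?_) isClosed_closedBall
  have mem_support : z - y ∈ Function.support (ρ.normed μ) := hy
  rw [ρ.support_normed_eq, mem_ball_zero_iff, ← dist_eq_norm, dist_comm] at mem_support
  exact mem_closedBall.2 mem_support.le

theorem fderiv_convolution_lsmul_apply {V : Type*} [NormedAddCommGroup V] [NormedSpace ℝ V]
    [MeasurableSpace V] [BorelSpace V] {μ : Measure V} [SFinite μ] [μ.IsAddLeftInvariant]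
    [μ.IsNegInvariant] {f w : V → ℝ} (hfc : HasCompactSupport f) (hf : ContDiff ℝ 1 f)
    (hw : LocallyIntegrable w μ) (z a : V) :
    fderiv ℝ (f ⋆[lsmul ℝ ℝ, μ] w) z a = - ∫ y, w y * fderiv ℝ (fun y => f (z - y)) y a ∂μ := by
  have fderiv_reflection (y : V) : fderiv ℝ (fun y => f (z - y)) y a = -fderiv ℝ f (z - y) a := by
    have fderiv_comp : fderiv ℝ (fun y => f (z - y)) y
        = fderiv ℝ f (z - y) ∘L (-ContinuousLinearMap.id ℝ V) :=
      (((hf.differentiable one_ne_zero) (z - y)).hasFDerivAt.comp y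
        ((hasFDerivAt_id y).const_sub z)).fderiv
    simp [fderiv_comp]
  have integrable := ((hfc.fderiv ℝ).convolutionExists_left
    ((lsmul ℝ ℝ : ℝ →L[ℝ] ℝ →L[ℝ] ℝ).precompL V)
    (hf.continuous_fderiv one_ne_zero) hw z).integrable
  rw [(hfc.hasFDerivAt_convolution_left (lsmul ℝ ℝ) hf hw z).fderiv, convolution_def,
    ContinuousLinearMap.integral_apply integrable, ← integral_neg,
    ← integral_sub_left_eq_self (μ := μ) (x' := z)]
  refine integral_congr_ae (Eventually.of_forall fun y => ?_)
  simp only [ContinuousLinearMap.precompL_apply, ContinuousLinearMap.lsmul_apply, smul_eq_mul,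
    sub_sub_cancel, fderiv_reflection]
  ring

theorem inner_convolution_lsmul {V F : Type*} [NormedAddCommGroup V]
    [MeasurableSpace V] [BorelSpace V] {μ : Measure V} [μ.IsAddLeftInvariant] [μ.IsNegInvariant]
    [NormedAddCommGroup F] [InnerProductSpace ℝ F] [CompleteSpace F] {f : V → ℝ} {w : V → F}
    (hfc : HasCompactSupport f) (hf : Continuous f) (hw : LocallyIntegrable w μ) (z : V) (v : F) :
    inner ℝ ((f ⋆[lsmul ℝ ℝ, μ] w) z) v = ∫ y, inner ℝ (w y) v * f (z - y) ∂μ := by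
  have integrable : Integrable (fun y => f y • w (z - y)) μ :=
    (hfc.convolutionExists_left (lsmul ℝ ℝ) hf hw z).integrable
  rw [convolution_lsmul, real_inner_comm, ← integral_inner integrable,
    ← integral_sub_left_eq_self _ μ z]
  refine integral_congr_ae (Eventually.of_forall fun y => ?_)
  simp only [sub_sub_cancel, real_inner_smul_right, real_inner_comm v (w y)]
  ring

variable {d : ℕ}

instance : (volume : Measure (𝔼^d × ℝ)).IsAddHaarMeasure :=
  inferInstanceAs ((volume.prod volume).IsAddHaarMeasure)

variable {Ω : Set (𝔼^d × ℝ)} {u : 𝔼^d × ℝ → ℝ} {G : 𝔼^d × ℝ → WithLp 2 (𝔼^d × ℝ)}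

theorem HasWeakGradient.prodGradient_normed_convolution (h : HasWeakGradient Ω u G)
    (hΩ : MeasurableSet Ω) (hu : LocallyIntegrable (Ω.indicator u) volume)
    (hG : LocallyIntegrable (Ω.indicator G) volume) (ρ : ContDiffBump (0 : 𝔼^d × ℝ))
    {z : 𝔼^d × ℝ} (hz : closedBall z ρ.rOut ⊆ Ω) :
    prodGradient (ρ.normed volume ⋆[lsmul ℝ ℝ, volume] Ω.indicator u) z
      = (ρ.normed volume ⋆[lsmul ℝ ℝ, volume] Ω.indicator G) z := by
  refine ext_inner_right ℝ fun v => ?_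
  set φ : 𝔼^d × ℝ → ℝ := fun y => ρ.normed volume (z - y)
  have φ_smooth : ContDiff ℝ ((⊤ : ℕ∞) : WithTop ℕ∞) φ :=
    ρ.contDiff_normed.comp (contDiff_const.sub contDiff_id)
  have tsupport_subset : tsupport φ ⊆ closedBall z ρ.rOut :=
    tsupport_normed_sub_subset_closedBall ρ z
  have φ_compact : HasCompactSupport φ :=
    (isCompact_closedBall z ρ.rOut).of_isClosed_subset (isClosed_tsupport φ) tsupport_subset
  calc inner ℝ (prodGradient (ρ.normed volume ⋆[lsmul ℝ ℝ, volume] Ω.indicator u) z) v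
      = - ∫ y, Ω.indicator u y * fderiv ℝ φ y (v.fst, v.snd) := by
        rw [inner_prodGradient, fderiv_convolution_lsmul_apply ρ.hasCompactSupport_normed
          ρ.contDiff_normed hu]
    _ = - ∫ y in Ω, u y * fderiv ℝ φ y (v.fst, v.snd) := by
        simp only [← integral_indicator hΩ, indicator_mul_left]
    _ = ∫ y in Ω, inner ℝ (G y) v * φ y := by
        rw [h φ φ_smooth φ_compact (tsupport_subset.trans hz) v, neg_neg]
    _ = ∫ y, inner ℝ (Ω.indicator G y) v * φ y := by
        rw [← integral_indicator hΩ]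
        congr 1 with y
        by_cases hy : y ∈ Ω <;> simp [hy]
    _ = inner ℝ ((ρ.normed volume ⋆[lsmul ℝ ℝ, volume] Ω.indicator G) z) v :=
        (inner_convolution_lsmul ρ.hasCompactSupport_normed ρ.continuous_normed hG z v).symm

end WeakGradientMollification

section Translations

variable {V : Type*} [NormedAddCommGroup V]

/-- Arbitrarily small translations carry `A` into `Ω`, at a positive distance from the complement
of `Ω`. -/
def TranslatesInto (A Ω : Set V) : Prop :=
  ∀ ε > 0, ∃ b, ‖b‖ < ε ∧ ∃ δ > 0, ∀ z ∈ A, closedBall (z + b) δ ⊆ Ω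

/-- A uniform version of the segment condition: near each point of its closure, `Ω` can be pushed
into itself by arbitrarily small translations. -/
def HasInwardTranslations (Ω : Set V) : Prop :=
  ∀ p ∈ closure Ω, ∃ r > 0, TranslatesInto (Ω ∩ ball p r) Ω

theorem TranslatesInto.closure {A Ω : Set V} (h : TranslatesInto A Ω) :
    TranslatesInto (closure A) Ω := by
  intro ε hε
  obtain ⟨b, hb, δ, hδ, hbδ⟩ := h ε hε
  refine ⟨b, hb, δ / 2, half_pos hδ, fun z hz => ?_⟩
  obtain ⟨a, ha, hza⟩ := Metric.mem_closure_iff.1 hz (δ / 2) (half_pos hδ)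
  refine (closedBall_subset_closedBall' ?_).trans (hbδ a ha)
  rw [dist_add_right]
  linarith

theorem TranslatesInto.exists_tendsto {A Ω : Set V} (h : TranslatesInto A Ω) :
    ∃ (ρ : ℕ → ContDiffBump (0 : V)) (b : ℕ → V), Tendsto (fun k => (ρ k).rOut) atTop (𝓝 0) ∧
      Tendsto b atTop (𝓝 0) ∧ ∀ k, ∀ z ∈ A, closedBall (z + b k) (ρ k).rOut ⊆ Ω := by
  have scale_pos (k : ℕ) : 0 < 1 / ((k : ℝ) + 1) := Nat.one_div_pos_of_nat
  choose b hb δ hδ hbδ using fun k : ℕ => h _ (scale_pos k)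
  have radius_pos (k : ℕ) : 0 < min (δ k) (1 / ((k : ℝ) + 1)) := lt_min (hδ k) (scale_pos k)
  refine ⟨fun k => ⟨_, _, half_pos (radius_pos k), half_lt_self (radius_pos k)⟩, b,
    squeeze_zero (fun k => (radius_pos k).le) (fun k => min_le_right _ _)
      tendsto_one_div_add_atTop_nhds_zero_nat,
    squeeze_zero_norm (fun k => (hb k).le) tendsto_one_div_add_atTop_nhds_zero_nat,
    fun k z hz => (closedBall_subset_closedBall (min_le_left _ _)).trans (hbδ k z hz)⟩

end Translations

section SubgraphTranslations

variable {d : ℕ} {ω : Set (𝔼^d)} {η : 𝔼^d → ℝ}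

theorem translatesInto_subgraphDomain {A : Set (𝔼^d × ℝ)} {v : 𝔼^d} {ρ : ℝ} (hρ : 0 < ρ)
    (hcone : ∀ z ∈ A, z.1 ∈ ω ∧ ContainsConeAt ω v ρ z.1) (hη : UniformContinuousOn η ω)
    (hshift : ∀ ε > 0, ∃ σ : ℝ, |σ| < ε ∧ ∃ κ > 0, ∀ z ∈ A, ∀ y ∈ ω, |η y - η z.1| ≤ κ →
      ∀ t, |t - (z.2 + σ)| ≤ κ → t ∈ Ioo 0 (η y)) :
    TranslatesInto A (subgraphDomain ω η) := by
  intro ε hε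
  obtain ⟨σ, hσ, κ, hκ, shift⟩ := hshift ε hε
  obtain ⟨τ, hτ, modulus⟩ := Metric.uniformContinuousOn_iff.1 hη κ hκ
  obtain ⟨c, hc, small⟩ := exists_pos_mul_lt (lt_min (lt_min hτ hε) hρ) (‖v‖ + 1)
  simp only [lt_min_iff, add_mul, one_mul] at small
  have shift_nonneg : 0 ≤ ‖v‖ * c := by positivity
  have norm_smul_v : ‖c • v‖ = ‖v‖ * c := by rw [norm_smul, Real.norm_of_nonneg hc.le, mul_comm]
  refine ⟨(c • v, σ), ?_, min (c / 2) κ, by positivity, fun z hz q hq => ?_⟩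
  · rw [Prod.norm_mk, norm_smul_v, max_lt_iff]
    exact ⟨by linarith, hσ⟩
  obtain ⟨hz_mem, hz_cone⟩ := hcone z hz
  rw [mem_closedBall, Prod.dist_eq, max_le_iff, Prod.fst_add, Prod.snd_add, le_min_iff,
    le_min_iff] at hq
  have q_mem : q.1 ∈ ω := hz_cone c ⟨hc, by linarith⟩ (mem_ball.2 (by linarith [hq.1.1]))
  have dist_lt : dist q.1 z.1 < τ := by
    have := dist_triangle q.1 (z.1 + c • v) z.1
    rw [dist_self_add_left, norm_smul_v] at this
    linarith [hq.1.1]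
  exact ⟨q_mem, shift z hz q.1 q_mem (modulus q.1 q_mem z.1 hz_mem dist_lt).le q.2 hq.2.2⟩

theorem hasInwardTranslations_subgraphDomain (hω : HasInteriorCones ω)
    (hη : UniformContinuousOn η ω) {m : ℝ} (hm0 : 0 < m) (hm : ∀ x ∈ ω, m ≤ η x) :
    HasInwardTranslations (subgraphDomain ω η) := by
  rintro ⟨x₀, t₀⟩ hp
  have hx₀ : x₀ ∈ closure ω := map_mem_closure continuous_fst hp fun z hz => hz.1
  obtain ⟨v, ρ, hρ, cones⟩ := hω x₀ hx₀
  have near {z : 𝔼^d × ℝ} (hz : z ∈ ball (x₀, t₀) (min ρ (m / 4))) :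
      dist z.1 x₀ < ρ ∧ |z.2 - t₀| < m / 4 := by
    rw [mem_ball, Prod.dist_eq, max_lt_iff, lt_min_iff, lt_min_iff] at hz
    exact ⟨hz.1.1, hz.2.2⟩
  refine ⟨min ρ (m / 4), by positivity, translatesInto_subgraphDomain hρ
    (fun z hz => ⟨hz.1.1, cones z.1 hz.1.1 (near hz.2).1⟩) hη fun ε hε => ?_⟩
  have step_pos : 0 < min (ε / 2) (m / 8) := by positivity
  have step_lt : min (ε / 2) (m / 8) < ε := (min_le_left _ _).trans_lt (half_lt_self hε)
  have step_le : min (ε / 2) (m / 8) ≤ m / 8 := min_le_right _ _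
  set σ := min (ε / 2) (m / 8)
  -- Points at low height are pushed up, below the minimum of `η`; the others are pushed down.
  by_cases ht₀ : t₀ < m / 2
  · refine ⟨σ, by rwa [abs_of_pos step_pos], σ / 4, by positivity, fun z hz y hy _ t ht => ?_⟩
    have hz₂ := abs_lt.1 (near hz.2).2
    rw [abs_le] at ht
    exact ⟨by linarith [hz.1.2.1], by linarith [hm y hy]⟩
  · refine ⟨-σ, by rwa [abs_neg, abs_of_pos step_pos], σ / 4, by positivity,
      fun z hz y _ hyz t ht => ?_⟩
    have hz₂ := abs_lt.1 (near hz.2).2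
    rw [abs_le] at ht hyz
    exact ⟨by linarith, by linarith [hz.1.2.2]⟩

end SubgraphTranslations

section SmoothApproximation

variable {d : ℕ}

/-- The functions `W k` are continuously differentiable approximations on `A ⊆ Ω` of a function
`u` on `Ω` with weak gradient `G`: in the `H¹` norm on `A`, and uniformly on `closure A` if `u` has
a representative which is continuous on `closure Ω`. -/
structure IsSmoothApproxOn (Ω A : Set (𝔼^d × ℝ)) (u : 𝔼^d × ℝ → ℝ)
    (G : 𝔼^d × ℝ → WithLp 2 (𝔼^d × ℝ)) (W : ℕ → 𝔼^d × ℝ → ℝ) : Prop where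
  contDiff : ∀ k, ContDiff ℝ 1 (W k)
  tendsto_eLpNorm_sub :
    Tendsto (fun k => eLpNorm (fun z => W k z - u z) 2 (volume.restrict A)) atTop (𝓝 0)
  tendsto_eLpNorm_prodGradient_sub :
    Tendsto (fun k => eLpNorm (fun z => prodGradient (W k) z - G z) 2 (volume.restrict A))
      atTop (𝓝 0)
  tendstoUniformlyOn : ∀ f, ContinuousOn f (closure Ω) → u =ᵐ[volume.restrict Ω] f →
    TendstoUniformlyOn W f atTop (closure A)

theorem prodGradient_comp_add_right {E : Type*} [NormedAddCommGroup E] [InnerProductSpace ℝ E]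
    [CompleteSpace E] (φ : E × ℝ → ℝ) (b z : E × ℝ) :
    prodGradient (fun z => φ (z + b)) z = prodGradient φ (z + b) := by
  simp only [prodGradient, fderiv_comp_add_right]

theorem tendstoUniformlyOn_normed_convolution_comp_add {V F : Type*} [NormedAddCommGroup V]
    [NormedSpace ℝ V] [FiniteDimensional ℝ V] [MeasurableSpace V] [BorelSpace V] {μ : Measure V}
    [μ.IsAddHaarMeasure] [NormedAddCommGroup F] [NormedSpace ℝ F] [CompleteSpace F]
    {Ω A B : Set V} {w f : V → F} (hf : UniformContinuousOn f B) (hΩB : Ω ⊆ B) (hAB : A ⊆ B)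
    (hw : AEStronglyMeasurable w μ) (hfw : w =ᵐ[μ] Ω.indicator f)
    {ρ : ℕ → ContDiffBump (0 : V)} {b : ℕ → V}
    (hρ : Tendsto (fun k => (ρ k).rOut) atTop (𝓝 0)) (hb : Tendsto b atTop (𝓝 0))
    (hball : ∀ k, ∀ z ∈ A, closedBall (z + b k) (ρ k).rOut ⊆ Ω) :
    TendstoUniformlyOn (fun k z => ((ρ k).normed μ ⋆[lsmul ℝ ℝ, μ] w) (z + b k)) f atTop A := by
  refine Metric.tendstoUniformlyOn_iff.2 fun ε hε => ?_
  obtain ⟨τ, hτ, modulus⟩ := Metric.uniformContinuousOn_iff.1 hf _ (half_pos hε)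
  filter_upwards [hρ.eventually_lt_const (half_pos hτ),
    Metric.tendsto_nhds.1 hb _ (half_pos hτ)] with k hρk hbk z hz
  have near : ∀ y ∈ ball (z + b k) (ρ k).rOut, dist (Ω.indicator f y) (f z) ≤ ε / 2 := by
    intro y hy
    have hyΩ : y ∈ Ω := hball k z hz (ball_subset_closedBall hy)
    rw [indicator_of_mem hyΩ]
    refine (modulus y (hΩB hyΩ) z (hAB hz) ?_).le
    have triangle := dist_triangle y (z + b k) z
    rw [dist_self_add_left, ← dist_zero_right] at triangle
    linarith [mem_ball.1 hy]
  rw [convolution_congr _ EventuallyEq.rfl hfw, dist_comm]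
  exact (dist_convolution_le (half_pos hε).le (ρ k).support_normed_eq.subset (ρ k).nonneg_normed
    (ρ k).integral_normed (hw.congr hfw) near).trans_lt (half_lt_self hε)

theorem tendsto_eLpNorm_restrict_of_norm_le_indicator {X F F' : Type*} [MeasurableSpace X]
    [NormedAddCommGroup F] [NormedAddCommGroup F'] {μ : Measure X} {A B : Set X}
    (hA : MeasurableSet A) (hB : MeasurableSet B) {p : ℝ≥0∞} {f : ℕ → X → F} {g : ℕ → X → F'}
    {C : ℝ} (hgf : ∀ k, ∀ z ∈ B, ‖g k z‖ ≤ C * ‖A.indicator (f k) z‖)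
    (hf : Tendsto (fun k => eLpNorm (f k) p (μ.restrict A)) atTop (𝓝 0)) :
    Tendsto (fun k => eLpNorm (g k) p (μ.restrict B)) atTop (𝓝 0) := by
  have scaled :
      Tendsto (fun k => ENNReal.ofReal C * eLpNorm (f k) p (μ.restrict A)) atTop (𝓝 0) := by
    simpa using ENNReal.Tendsto.const_mul hf (.inr ENNReal.ofReal_ne_top)
  refine tendsto_of_tendsto_of_tendsto_of_le_of_le tendsto_const_nhds scaled (fun _ => zero_le)
    fun k => ?_
  calc eLpNorm (g k) p (μ.restrict B)
      ≤ ENNReal.ofReal C * eLpNorm (A.indicator (f k)) p (μ.restrict B) :=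
        eLpNorm_le_mul_eLpNorm_of_ae_le_mul (ae_restrict_of_forall_mem hB (hgf k)) p
    _ ≤ ENNReal.ofReal C * eLpNorm (A.indicator (f k)) p μ := by
        gcongr
        exact Measure.restrict_le_self
    _ = ENNReal.ofReal C * eLpNorm (f k) p (μ.restrict A) := by
        rw [eLpNorm_indicator_eq_eLpNorm_restrict hA]

theorem tendsto_eLpNorm_restrict_of_eqOn {X F : Type*} [MeasurableSpace X] [NormedAddCommGroup F]
    {μ : Measure X} {A : Set X} (hA : MeasurableSet A) {p : ℝ≥0∞} {f g : ℕ → X → F}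
    (hgf : ∀ k, EqOn (g k) (f k) A) (hf : Tendsto (fun k => eLpNorm (f k) p μ) atTop (𝓝 0)) :
    Tendsto (fun k => eLpNorm (g k) p (μ.restrict A)) atTop (𝓝 0) := by
  refine tendsto_of_tendsto_of_tendsto_of_le_of_le tendsto_const_nhds hf (fun _ => zero_le)
    fun k => ?_
  rw [eLpNorm_congr_ae (ae_restrict_of_forall_mem hA (hgf k))]
  exact eLpNorm_mono_measure _ Measure.restrict_le_self

theorem HasWeakGradient.exists_isSmoothApproxOn {Ω A : Set (𝔼^d × ℝ)} {u : 𝔼^d × ℝ → ℝ}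
    {G : 𝔼^d × ℝ → WithLp 2 (𝔼^d × ℝ)} (h : HasWeakGradient Ω u G) (hΩ : MeasurableSet Ω)
    (hΩb : Bornology.IsBounded Ω) (hu : StronglyMeasurable u) (hG : StronglyMeasurable G)
    (hu2 : MemLp u 2 (volume.restrict Ω)) (hG2 : MemLp G 2 (volume.restrict Ω))
    (hA : MeasurableSet A) (hAΩ : A ⊆ Ω) (htrans : TranslatesInto A Ω) :
    ∃ W, IsSmoothApproxOn Ω A u G W := by
  obtain ⟨ρ, b, hρ, hb, hball⟩ := htrans.closure.exists_tendsto
  rw [← memLp_indicator_iff_restrict hΩ] at hu2 hG2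
  have hu_loc := hu2.locallyIntegrable (by norm_num)
  have hG_loc := hG2.locallyIntegrable (by norm_num)
  refine ⟨fun k z => ((ρ k).normed volume ⋆[lsmul ℝ ℝ, volume] Ω.indicator u) (z + b k),
    fun k => ?_, ?_, ?_, fun f hf huf => ?_⟩
  · exact ((ρ k).hasCompactSupport_normed.contDiff_convolution_left (lsmul ℝ ℝ)
      (ρ k).contDiff_normed hu_loc).comp (contDiff_id.add contDiff_const)
  · refine tendsto_eLpNorm_restrict_of_eqOn hA (fun k z hz => ?_)
      (tendsto_eLpNorm_normed_convolution_comp_add_sub (hu.indicator hΩ) hu2 hρ hb)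
    simp only [indicator_of_mem (hAΩ hz)]
  · refine tendsto_eLpNorm_restrict_of_eqOn hA (fun k z hz => ?_)
      (tendsto_eLpNorm_normed_convolution_comp_add_sub (hG.indicator hΩ) hG2 hρ hb)
    simp only [indicator_of_mem (hAΩ hz), prodGradient_comp_add_right]
    rw [h.prodGradient_normed_convolution hΩ hu_loc hG_loc _ (hball k z (subset_closure hz))]
  · exact tendstoUniformlyOn_normed_convolution_comp_add
      (hΩb.isCompact_closure.uniformContinuousOn_of_continuous hf) subset_closure
      (closure_mono hAΩ) (hu.indicator hΩ).aestronglyMeasurable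
      ((ae_eq_restrict_iff_indicator_ae_eq hΩ).1 huf) hρ hb hball

end SmoothApproximation

section ProductGradientRules

variable {E : Type*} [NormedAddCommGroup E] [InnerProductSpace ℝ E] [CompleteSpace E]
  {φ ψ : E × ℝ → ℝ} {z : E × ℝ}

theorem prodGradient_add (hφ : DifferentiableAt ℝ φ z) (hψ : DifferentiableAt ℝ ψ z) :
    prodGradient (fun z => φ z + ψ z) z = prodGradient φ z + prodGradient ψ z := by
  refine ext_inner_right ℝ fun v => ?_
  simp only [inner_add_left, inner_prodGradient, fderiv_fun_add hφ hψ, add_apply]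

theorem prodGradient_mul (hφ : DifferentiableAt ℝ φ z) (hψ : DifferentiableAt ℝ ψ z) :
    prodGradient (fun z => φ z * ψ z) z = φ z • prodGradient ψ z + ψ z • prodGradient φ z := by
  refine ext_inner_right ℝ fun v => ?_
  simp only [inner_add_left, real_inner_smul_left, inner_prodGradient, fderiv_fun_mul hφ hψ,
    add_apply, smul_apply, smul_eq_mul]

theorem prodGradient_sum {ι : Type*} {s : Finset ι} {f : ι → E × ℝ → ℝ}
    (hf : ∀ i ∈ s, DifferentiableAt ℝ (f i) z) :
    prodGradient (fun z => ∑ i ∈ s, f i z) z = ∑ i ∈ s, prodGradient (f i) z := by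
  refine ext_inner_right ℝ fun v => ?_
  simp only [sum_inner, inner_prodGradient, fderiv_fun_sum hf, sum_apply]

theorem prodGradient_eq_zero_of_fderiv_eq_zero (h : fderiv ℝ φ z = 0) : prodGradient φ z = 0 := by
  simp only [prodGradient, h, ContinuousLinearMap.zero_comp, map_zero]

theorem support_prodGradient_subset : Function.support (prodGradient φ) ⊆ tsupport φ :=
  fun _ hz => support_fderiv_subset ℝ fun h => hz (prodGradient_eq_zero_of_fderiv_eq_zero h)

end ProductGradientRules

section ConvergenceInLp

variable {X F : Type*} [MeasurableSpace X] [NormedAddCommGroup F] {μ : Measure X} {p : ℝ≥0∞}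

theorem tendsto_eLpNorm_add_zero (hp : 1 ≤ p) {f g : ℕ → X → F}
    (hfm : ∀ k, AEStronglyMeasurable (f k) μ) (hgm : ∀ k, AEStronglyMeasurable (g k) μ)
    (hf : Tendsto (fun k => eLpNorm (f k) p μ) atTop (𝓝 0))
    (hg : Tendsto (fun k => eLpNorm (g k) p μ) atTop (𝓝 0)) :
    Tendsto (fun k => eLpNorm (f k + g k) p μ) atTop (𝓝 0) :=
  tendsto_of_tendsto_of_tendsto_of_le_of_le tendsto_const_nhds (by simpa using hf.add hg)
    (fun _ => zero_le) fun k => eLpNorm_add_le (hfm k) (hgm k) hp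

theorem tendsto_eLpNorm_sum_zero (hp : 1 ≤ p) {ι : Type*} [Fintype ι] {f : ι → ℕ → X → F}
    (hfm : ∀ i k, AEStronglyMeasurable (f i k) μ)
    (hf : ∀ i, Tendsto (fun k => eLpNorm (f i k) p μ) atTop (𝓝 0)) :
    Tendsto (fun k => eLpNorm (∑ i, f i k) p μ) atTop (𝓝 0) :=
  tendsto_of_tendsto_of_tendsto_of_le_of_le tendsto_const_nhds
    (by simpa using tendsto_finsetSum Finset.univ fun i _ => hf i)
    (fun _ => zero_le) fun k => eLpNorm_sum_le (fun i _ => hfm i k) hp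

end ConvergenceInLp

section Patching

open scoped Manifold

variable {d : ℕ} {Ω : Set (𝔼^d × ℝ)} {u : 𝔼^d × ℝ → ℝ} {G : 𝔼^d × ℝ → WithLp 2 (𝔼^d × ℝ)}
  {ι : Type*} [Fintype ι] {U : ι → Set (𝔼^d × ℝ)} {W : ι → ℕ → 𝔼^d × ℝ → ℝ}
  {χ : SmoothPartitionOfUnity ι 𝓘(ℝ, 𝔼^d × ℝ) (𝔼^d × ℝ) (closure Ω)}

theorem contDiff_smoothPartitionOfUnity {V : Type*} [NormedAddCommGroup V] [NormedSpace ℝ V]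
    {ι : Type*} {s : Set V} (χ : SmoothPartitionOfUnity ι 𝓘(ℝ, V) V s) (i : ι) :
    ContDiff ℝ 1 (χ i) :=
  (χ i).contMDiff.contDiff.of_le (by exact_mod_cast le_top)

theorem sum_mul_sub_eq_sum_mul_sub {V : Type*} {χ w : ι → V → ℝ} {f : V → ℝ}
    {z : V} (hχ : ∑ i, χ i z = 1) :
    ∑ i, χ i z * w i z - f z = ∑ i, χ i z * (w i z - f z) := by
  simp only [mul_sub, Finset.sum_sub_distrib, ← Finset.sum_mul, hχ, one_mul]

theorem prodGradient_sum_mul_sub_eq {χ w : ι → 𝔼^d × ℝ → ℝ} {z : 𝔼^d × ℝ}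
    (hχ : ∀ i, DifferentiableAt ℝ (χ i) z) (hw : ∀ i, DifferentiableAt ℝ (w i) z)
    (hsum : ∀ᶠ y in 𝓝 z, ∑ i, χ i y = 1) :
    prodGradient (fun z => ∑ i, χ i z * w i z) z - G z
      = ∑ i, χ i z • (prodGradient (w i) z - G z) + ∑ i, (w i z - u z) • prodGradient (χ i) z := by
  have sum_prodGradient : ∑ i, prodGradient (χ i) z = 0 := by
    rw [← prodGradient_sum fun i _ => hχ i]
    refine prodGradient_eq_zero_of_fderiv_eq_zero ?_
    rw [EventuallyEq.fderiv_eq hsum, fderiv_const_apply]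
  rw [prodGradient_sum (f := fun i z => χ i z * w i z) fun i _ => (hχ i).mul (hw i)]
  simp only [prodGradient_mul (hχ _) (hw _), smul_sub, sub_smul, Finset.sum_add_distrib,
    Finset.sum_sub_distrib, ← Finset.sum_smul, ← Finset.smul_sum, hsum.self_of_nhds,
    sum_prodGradient, one_smul, smul_zero]
  abel

theorem tendsto_eLpNorm_sum_of_norm_le_mul {X F F₁ F₂ : Type*} [MeasurableSpace X]
    [NormedAddCommGroup F] [NormedAddCommGroup F₁] [NormedAddCommGroup F₂] {μ : Measure X}
    {p : ℝ≥0∞} (hp : 1 ≤ p) {Ω : Set X} (hΩ : MeasurableSet Ω) {U : ι → Set X}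
    (hU : ∀ i, MeasurableSet (U i)) {a : ι → X → F₁} {f : ι → ℕ → X → F₂} {g : ι → ℕ → X → F}
    (ha : ∀ i, Function.support (a i) ⊆ U i) (ha_bdd : ∀ i, ∃ C, ∀ z ∈ Ω, ‖a i z‖ ≤ C)
    (hg : ∀ i k, AEStronglyMeasurable (g i k) (μ.restrict Ω))
    (hgf : ∀ i k z, ‖g i k z‖ ≤ ‖a i z‖ * ‖f i k z‖)
    (hf : ∀ i, Tendsto (fun k => eLpNorm (f i k) p (μ.restrict (Ω ∩ U i))) atTop (𝓝 0)) :
    Tendsto (fun k => eLpNorm (∑ i, g i k) p (μ.restrict Ω)) atTop (𝓝 0) := by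
  refine tendsto_eLpNorm_sum_zero hp hg fun i => ?_
  obtain ⟨C, hC⟩ := ha_bdd i
  refine tendsto_eLpNorm_restrict_of_norm_le_indicator (hΩ.inter (hU i)) hΩ (C := C)
    (fun k z hz => (hgf i k z).trans ?_) (hf i)
  by_cases hzU : z ∈ U i
  · rw [indicator_of_mem (mem_inter hz hzU)]
    gcongr
    exact hC z hz
  · simp [Function.notMem_support.1 fun h => hzU (ha i h), hzU]

theorem tendstoUniformlyOn_sum_mul {V : Type*} {K : Set V} {χ : ι → V → ℝ}
    (hχ0 : ∀ i z, 0 ≤ χ i z) (hχ1 : ∀ z ∈ K, ∑ i, χ i z = 1) {w : ι → ℕ → V → ℝ} {f : V → ℝ}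
    (hw : ∀ i, TendstoUniformlyOn (w i) f atTop (K ∩ Function.support (χ i))) :
    TendstoUniformlyOn (fun k z => ∑ i, χ i z * w i k z) f atTop K := by
  refine Metric.tendstoUniformlyOn_iff.2 fun ε hε => ?_
  filter_upwards [eventually_all.2 fun i => Metric.tendstoUniformlyOn_iff.1 (hw i) (ε / 2)
    (half_pos hε)] with k hk z hz
  have weighted_error_le (i : ι) : ‖χ i z * (w i k z - f z)‖ ≤ χ i z * (ε / 2) := by
    rw [norm_mul, Real.norm_of_nonneg (hχ0 i z)]
    by_cases hi : χ i z = 0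
    · simp only [hi, zero_mul, le_refl]
    · rw [← dist_eq_norm, dist_comm]
      exact mul_le_mul_of_nonneg_left (hk i z ⟨hz, hi⟩).le (hχ0 i z)
  rw [dist_comm, dist_eq_norm, sum_mul_sub_eq_sum_mul_sub (hχ1 z hz)]
  calc ‖∑ i, χ i z * (w i k z - f z)‖ ≤ ∑ i, χ i z * (ε / 2) :=
        norm_sum_le_of_le _ fun i _ => weighted_error_le i
    _ = ε / 2 := by rw [← Finset.sum_mul, hχ1 z hz, one_mul]
    _ < ε := half_lt_self hε

theorem tendsto_eLpNorm_sum_smul_of_isSubordinate {F : Type*} [NormedAddCommGroup F]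
    [NormedSpace ℝ F] (hΩ : MeasurableSet Ω) (hU : ∀ i, MeasurableSet (U i))
    (hχ : χ.IsSubordinate U) {f : ι → ℕ → 𝔼^d × ℝ → F}
    (hm : ∀ i k, AEStronglyMeasurable (f i k) (volume.restrict Ω))
    (hf : ∀ i, Tendsto (fun k => eLpNorm (f i k) 2 (volume.restrict (Ω ∩ U i))) atTop (𝓝 0)) :
    Tendsto (fun k => eLpNorm (∑ i, fun z => χ i z • f i k z) 2 (volume.restrict Ω))
      atTop (𝓝 0) :=
  tendsto_eLpNorm_sum_of_norm_le_mul one_le_two hΩ hU (a := fun i => χ i)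
    (fun i => (subset_tsupport _).trans (hχ i))
    (fun i => ⟨1, fun z _ => (Real.norm_of_nonneg (χ.nonneg i z)).trans_le (χ.le_one i z)⟩)
    (fun i k => (χ i).contMDiff.continuous.aestronglyMeasurable.smul (hm i k))
    (fun _ _ _ => (norm_smul _ _).le) hf

theorem tendsto_eLpNorm_sum_smul_prodGradient_of_isSubordinate (hΩ : MeasurableSet Ω)
    (hΩb : Bornology.IsBounded Ω) (hU : ∀ i, MeasurableSet (U i)) (hχ : χ.IsSubordinate U)
    {f : ι → ℕ → 𝔼^d × ℝ → ℝ} (hm : ∀ i k, AEStronglyMeasurable (f i k) (volume.restrict Ω))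
    (hf : ∀ i, Tendsto (fun k => eLpNorm (f i k) 2 (volume.restrict (Ω ∩ U i))) atTop (𝓝 0)) :
    Tendsto (fun k => eLpNorm (∑ i, fun z => f i k z • prodGradient (χ i) z) 2
      (volume.restrict Ω)) atTop (𝓝 0) := by
  have continuous_prodGradient_χ (i : ι) : Continuous (prodGradient (χ i)) :=
    continuous_prodGradient (contDiff_smoothPartitionOfUnity χ i)
  refine tendsto_eLpNorm_sum_of_norm_le_mul one_le_two hΩ hU (a := fun i => prodGradient (χ i))
    (fun i => support_prodGradient_subset.trans (hχ i)) (fun i => ?_)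
    (fun i k => (hm i k).smul (continuous_prodGradient_χ i).aestronglyMeasurable)
    (fun i k z => (norm_smul _ _).trans_le (mul_comm _ _).le) hf
  obtain ⟨C, hC⟩ := hΩb.isCompact_closure.exists_bound_of_continuousOn
    (continuous_prodGradient_χ i).continuousOn
  exact ⟨C, fun z hz => hC z (subset_closure hz)⟩

theorem IsSmoothApproxOn.aestronglyMeasurable_sub {A : Set (𝔼^d × ℝ)} {w : ℕ → 𝔼^d × ℝ → ℝ}
    {μ : Measure (𝔼^d × ℝ)} (hw : IsSmoothApproxOn Ω A u G w) (hu : AEStronglyMeasurable u μ)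
    (k : ℕ) : AEStronglyMeasurable (fun z => w k z - u z) μ :=
  (hw.contDiff k).continuous.aestronglyMeasurable.sub hu

theorem IsSmoothApproxOn.aestronglyMeasurable_prodGradient_sub {A : Set (𝔼^d × ℝ)}
    {w : ℕ → 𝔼^d × ℝ → ℝ} {μ : Measure (𝔼^d × ℝ)} (hw : IsSmoothApproxOn Ω A u G w)
    (hG : AEStronglyMeasurable G μ) (k : ℕ) :
    AEStronglyMeasurable (fun z => prodGradient (w k) z - G z) μ :=
  (continuous_prodGradient (hw.contDiff k)).aestronglyMeasurable.sub hG

theorem IsSmoothApproxOn.sum_mul (hΩ : IsOpen Ω) (hΩb : Bornology.IsBounded Ω)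
    (hu : AEStronglyMeasurable u (volume.restrict Ω))
    (hG : AEStronglyMeasurable G (volume.restrict Ω)) (hU : ∀ i, IsOpen (U i))
    (hχ : χ.IsSubordinate U) (hW : ∀ i, IsSmoothApproxOn Ω (Ω ∩ U i) u G (W i)) :
    IsSmoothApproxOn Ω Ω u G fun k z => ∑ i, χ i z * W i k z := by
  have χ_contDiff (i : ι) : ContDiff ℝ 1 (χ i) := contDiff_smoothPartitionOfUnity χ i
  have sum_χ {z} (hz : z ∈ closure Ω) : ∑ i, χ i z = 1 :=
    (finsum_eq_sum_of_fintype _).symm.trans (χ.sum_eq_one hz)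
  have hΩm := hΩ.measurableSet
  have hUm (i : ι) := (hU i).measurableSet
  have error_measurable (i : ι) (k : ℕ) := (hW i).aestronglyMeasurable_sub hu k
  have gradient_error_measurable (i : ι) (k : ℕ) :=
    (hW i).aestronglyMeasurable_prodGradient_sub hG k
  refine ⟨fun k => ContDiff.sum fun i _ => (χ_contDiff i).mul ((hW i).contDiff k), ?_, ?_,
    fun f hf huf => tendstoUniformlyOn_sum_mul χ.nonneg (fun _ => sum_χ) fun i => ?_⟩
  · refine (tendsto_eLpNorm_sum_smul_of_isSubordinate hΩm hUm hχ error_measurable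
      fun i => (hW i).tendsto_eLpNorm_sub).congr fun k =>
        eLpNorm_congr_ae (ae_restrict_of_forall_mem hΩm fun z hz => ?_)
    exact (Finset.sum_apply z _ _).trans
      (sum_mul_sub_eq_sum_mul_sub (sum_χ (subset_closure hz))).symm
  · have gradient_tendsto := tendsto_eLpNorm_sum_smul_of_isSubordinate hΩm hUm hχ
      gradient_error_measurable fun i => (hW i).tendsto_eLpNorm_prodGradient_sub
    have cutoff_tendsto := tendsto_eLpNorm_sum_smul_prodGradient_of_isSubordinate hΩm hΩb hUm hχ
      error_measurable fun i => (hW i).tendsto_eLpNorm_sub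
    refine (tendsto_eLpNorm_add_zero one_le_two (fun k => ?_) (fun k => ?_) gradient_tendsto
      cutoff_tendsto).congr fun k =>
        eLpNorm_congr_ae (ae_restrict_of_forall_mem hΩm fun z hz => ?_)
    · exact Finset.aestronglyMeasurable_sum _ fun i _ =>
        (χ_contDiff i).continuous.aestronglyMeasurable.smul (gradient_error_measurable i k)
    · exact Finset.aestronglyMeasurable_sum _ fun i _ => (error_measurable i k).smul
        (continuous_prodGradient (χ_contDiff i)).aestronglyMeasurable
    · rw [Pi.add_apply, Finset.sum_apply, Finset.sum_apply]
      exact (prodGradient_sum_mul_sub_eq (fun i => (χ_contDiff i).differentiable one_ne_zero z)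
        (fun i => ((hW i).contDiff k).differentiable one_ne_zero z)
        ((hΩ.eventually_mem hz).mono fun y hy => sum_χ (subset_closure hy))).symm
  · refine ((hW i).tendstoUniformlyOn f hf huf).mono fun z hz => ?_
    rw [inter_comm]
    exact (hU i).inter_closure ⟨hχ i (subset_tsupport _ hz.2), hz.1⟩

theorem HasWeakGradient.exists_isSmoothApproxOn_of_hasInwardTranslations
    (h : HasWeakGradient Ω u G) (hΩ : IsOpen Ω) (hΩb : Bornology.IsBounded Ω)
    (htrans : HasInwardTranslations Ω) (hu : StronglyMeasurable u) (hG : StronglyMeasurable G)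
    (hu2 : MemLp u 2 (volume.restrict Ω)) (hG2 : MemLp G 2 (volume.restrict Ω)) :
    ∃ φ, IsSmoothApproxOn Ω Ω u G φ := by
  choose! r hr0 hr using htrans
  obtain ⟨t, ht, closure_subset⟩ := hΩb.isCompact_closure.elim_nhds_subcover (fun p => ball p (r p))
    fun p hp => ball_mem_nhds p (hr0 p hp)
  obtain ⟨χ, hχ⟩ := SmoothPartitionOfUnity.exists_isSubordinate 𝓘(ℝ, 𝔼^d × ℝ) isClosed_closure
    (fun p : t => ball p.1 (r p)) (fun _ => isOpen_ball)
    (by rwa [iUnion_subtype])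
  choose W hW using fun p : t => h.exists_isSmoothApproxOn hΩ.measurableSet hΩb hu hG hu2 hG2
    (hΩ.measurableSet.inter measurableSet_ball) inter_subset_left (hr p (ht p p.2))
  exact ⟨_, IsSmoothApproxOn.sum_mul hΩ hΩb hu.aestronglyMeasurable hG.aestronglyMeasurable
    (fun _ => isOpen_ball) hχ hW⟩

end Patching

section ProductsOfLp

variable {X Y F₁ F₂ : Type*} [MeasurableSpace X] [MeasurableSpace Y] [NormedAddCommGroup F₁]
  [NormedAddCommGroup F₂] {μ : Measure X} {ν : Measure Y}

theorem ofReal_norm_sq_of_ae_eq {V : WithLp 2 (Lp F₁ 2 μ × Lp F₂ 2 ν)} {f : X → F₁} {g : Y → F₂}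
    (hf : V.fst =ᵐ[μ] f) (hg : V.snd =ᵐ[ν] g) :
    ENNReal.ofReal (‖V‖ ^ 2) = (∫⁻ x, ‖f x‖ₑ ^ 2 ∂μ) + ∫⁻ y, ‖g y‖ₑ ^ 2 ∂ν := by
  rw [WithLp.prod_norm_sq_eq_of_L2, ENNReal.ofReal_add (sq_nonneg _) (sq_nonneg _),
    ENNReal.ofReal_pow (norm_nonneg _), ENNReal.ofReal_pow (norm_nonneg _), Lp.norm_def,
    Lp.norm_def, ENNReal.ofReal_toReal (Lp.eLpNorm_ne_top _),
    ENNReal.ofReal_toReal (Lp.eLpNorm_ne_top _), eLpNorm_congr_ae hf, eLpNorm_congr_ae hg,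
    sq_eLpNorm_two, sq_eLpNorm_two]

theorem tendsto_prod_Lp_of_ae_eq {V : ℕ → WithLp 2 (Lp F₁ 2 μ × Lp F₂ 2 ν)}
    {V₀ : WithLp 2 (Lp F₁ 2 μ × Lp F₂ 2 ν)} {f : ℕ → X → F₁} {g : ℕ → Y → F₂}
    (hVf : ∀ k, (V k).fst =ᵐ[μ] f k) (hVg : ∀ k, (V k).snd =ᵐ[ν] g k)
    (hf : Tendsto (fun k => eLpNorm (fun x => f k x - V₀.fst x) 2 μ) atTop (𝓝 0))
    (hg : Tendsto (fun k => eLpNorm (fun y => g k y - V₀.snd y) 2 ν) atTop (𝓝 0)) :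
    Tendsto V atTop (𝓝 V₀) := by
  refine (WithLp.homeomorphProd 2 _ _).isInducing.tendsto_nhds_iff.2 (Tendsto.prodMk_nhds ?_ ?_)
  · exact (Lp.tendsto_Lp_iff_tendsto_eLpNorm' _ _).2 (hf.congr fun k =>
      eLpNorm_congr_ae ((hVf k).symm.sub .rfl))
  · exact (Lp.tendsto_Lp_iff_tendsto_eLpNorm' _ _).2 (hg.congr fun k =>
      eLpNorm_congr_ae ((hVg k).symm.sub .rfl))

theorem exists_strictMono_tendsto_ae_of_tendsto_Lp {V : ℕ → Lp F₁ 2 μ} {V₀ : Lp F₁ 2 μ}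
    (h : Tendsto V atTop (𝓝 V₀)) :
    ∃ n : ℕ → ℕ, StrictMono n ∧ ∀ᵐ x ∂μ, Tendsto (fun k => V (n k) x) atTop (𝓝 (V₀ x)) :=
  (tendstoInMeasure_of_tendsto_Lp h).exists_seq_tendsto_ae

end ProductsOfLp

theorem memLp_restrict_of_continuousOn_closure {X F : Type*} [PseudoMetricSpace X] [ProperSpace X]
    [MeasurableSpace X] [OpensMeasurableSpace X] [NormedAddCommGroup F] {μ : Measure X}
    [IsFiniteMeasureOnCompacts μ] {p : ℝ≥0∞} {f : X → F} {s : Set X} (hs : MeasurableSet s)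
    (hb : Bornology.IsBounded s) (hf : ContinuousOn f (closure s)) :
    MemLp f p (μ.restrict s) := by
  obtain ⟨C, hC⟩ := hb.isCompact_closure.exists_bound_of_continuousOn hf
  have : IsFiniteMeasure (μ.restrict s) :=
    isFiniteMeasure_restrict.2 (measure_lt_top_of_subset subset_closure
      hb.isCompact_closure.measure_lt_top.ne).ne
  exact MemLp.of_bound ((hf.mono subset_closure).aestronglyMeasurable hs) C
    (ae_restrict_of_forall_mem hs fun x hx => hC x (subset_closure hx))

section ContDiffInH1

variable {d : ℕ} {Ω : Set (𝔼^d × ℝ)}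

theorem hasWeakGradient_prodGradient {φ : 𝔼^d × ℝ → ℝ} (hφ : ContDiff ℝ 1 φ) :
    HasWeakGradient Ω φ (prodGradient φ) := by
  intro ψ hψ hψ_supp hψΩ v
  have fderivφ_continuous : Continuous fun z => fderiv ℝ φ z (v.fst, v.snd) :=
    (hφ.continuous_fderiv one_ne_zero).clm_apply continuous_const
  have fderivψ_continuous : Continuous fun z => fderiv ℝ ψ z (v.fst, v.snd) :=
    (hψ.continuous_fderiv (by simp)).clm_apply continuous_const
  have fderivψ_supp : HasCompactSupport fun z => fderiv ℝ ψ z (v.fst, v.snd) :=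
    hψ_supp.fderiv_apply ℝ (v.fst, v.snd)
  simp only [inner_prodGradient]
  rw [setIntegral_eq_integral_of_forall_compl_eq_zero fun z hz => ?_,
    setIntegral_eq_integral_of_forall_compl_eq_zero fun z hz => ?_]
  · exact integral_mul_fderiv_eq_neg_fderiv_mul_of_integrable
      ((fderivφ_continuous.mul hψ.continuous).integrable_of_hasCompactSupport hψ_supp.mul_left)
      ((hφ.continuous.mul fderivψ_continuous).integrable_of_hasCompactSupport fderivψ_supp.mul_left)
      ((hφ.continuous.mul hψ.continuous).integrable_of_hasCompactSupport hψ_supp.mul_left)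
      (fun z _ => hφ.differentiable one_ne_zero z) (fun z _ => hψ.differentiable (by simp) z)
  · rw [image_eq_zero_of_notMem_tsupport fun h => hz (hψΩ h), mul_zero]
  · rw [fderiv_of_notMem_tsupport ℝ fun h => hz (hψΩ h), zero_apply, mul_zero]

theorem HasWeakGradient.congr_ae {u u' : 𝔼^d × ℝ → ℝ} {G G' : 𝔼^d × ℝ → WithLp 2 (𝔼^d × ℝ)}
    (h : HasWeakGradient Ω u G) (hu : u =ᵐ[volume.restrict Ω] u')
    (hG : G =ᵐ[volume.restrict Ω] G') : HasWeakGradient Ω u' G' := by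
  intro ψ hψ hψ_supp hψΩ v
  calc ∫ z in Ω, u' z * fderiv ℝ ψ z (v.fst, v.snd)
      = ∫ z in Ω, u z * fderiv ℝ ψ z (v.fst, v.snd) :=
        integral_congr_ae (hu.mono fun z hz => by simp only [hz])
    _ = -∫ z in Ω, inner ℝ (G z) v * ψ z := h ψ hψ hψ_supp hψΩ v
    _ = -∫ z in Ω, inner ℝ (G' z) v * ψ z :=
        congrArg Neg.neg (integral_congr_ae (hG.mono fun z hz => by simp only [hz]))

theorem prodGradient_const_smul {φ : 𝔼^d × ℝ → ℝ} (c : ℝ) :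
    prodGradient (c • φ) = c • prodGradient φ := by
  refine funext fun z => ext_inner_right ℝ fun v => ?_
  simp only [Pi.smul_apply, real_inner_smul_left, inner_prodGradient, fderiv_const_smul_field,
    smul_apply, smul_eq_mul]

/-- The real vector space of `C¹` functions on `ℝ^d × ℝ`, the domain on which the trace operator is
first defined. -/
def contDiffSubmodule (d : ℕ) : Submodule ℝ (𝔼^d × ℝ → ℝ) where
  carrier := {φ | ContDiff ℝ 1 φ}
  zero_mem' := (contDiff_const : ContDiff ℝ 1 fun _ => (0 : ℝ))
  add_mem' := fun {φ ψ} (hφ : ContDiff ℝ 1 φ) (hψ : ContDiff ℝ 1 ψ) => hφ.add hψ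
  smul_mem' := fun c φ (hφ : ContDiff ℝ 1 φ) => hφ.const_smul c

theorem contDiff_coe (φ : contDiffSubmodule d) : ContDiff ℝ 1 (φ : 𝔼^d × ℝ → ℝ) := φ.2

theorem memLp_contDiff (hΩ : MeasurableSet Ω) (hΩb : Bornology.IsBounded Ω)
    (φ : contDiffSubmodule d) : MemLp φ.1 2 (volume.restrict Ω) :=
  memLp_restrict_of_continuousOn_closure hΩ hΩb (contDiff_coe φ).continuous.continuousOn

theorem memLp_prodGradient (hΩ : MeasurableSet Ω) (hΩb : Bornology.IsBounded Ω)
    (φ : contDiffSubmodule d) : MemLp (prodGradient φ.1) 2 (volume.restrict Ω) :=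
  memLp_restrict_of_continuousOn_closure hΩ hΩb
    (continuous_prodGradient (contDiff_coe φ)).continuousOn

/-- The inclusion of the `C¹` functions into `H¹(Ω)`, for a bounded measurable set `Ω`. -/
noncomputable def contDiffToH1 (hΩ : MeasurableSet Ω) (hΩb : Bornology.IsBounded Ω) :
    contDiffSubmodule d →ₗ[ℝ] H1 Ω where
  toFun φ := ⟨WithLp.toLp 2 ((memLp_contDiff hΩ hΩb φ).toLp, (memLp_prodGradient hΩ hΩb φ).toLp),
    (hasWeakGradient_prodGradient (contDiff_coe φ)).congr_ae
      (memLp_contDiff hΩ hΩb φ).coeFn_toLp.symm (memLp_prodGradient hΩ hΩb φ).coeFn_toLp.symm⟩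
  map_add' φ ψ := by
    refine Subtype.ext (WithLp.ofLp_injective 2 (Prod.ext
      (MemLp.toLp_add (memLp_contDiff hΩ hΩb φ) (memLp_contDiff hΩ hΩb ψ)) ?_))
    refine (MemLp.toLp_congr (memLp_prodGradient hΩ hΩb (φ + ψ))
      ((memLp_prodGradient hΩ hΩb φ).add (memLp_prodGradient hΩ hΩb ψ))
      (.of_forall fun z => ?_)).trans
      (MemLp.toLp_add (memLp_prodGradient hΩ hΩb φ) (memLp_prodGradient hΩ hΩb ψ))
    exact prodGradient_add ((contDiff_coe φ).differentiable one_ne_zero z)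
      ((contDiff_coe ψ).differentiable one_ne_zero z)
  map_smul' c φ := by
    refine Subtype.ext (WithLp.ofLp_injective 2 (Prod.ext
      (MemLp.toLp_const_smul c (memLp_contDiff hΩ hΩb φ)) ?_))
    exact (MemLp.toLp_congr (memLp_prodGradient hΩ hΩb (c • φ))
      ((memLp_prodGradient hΩ hΩb φ).const_smul c)
      (.of_forall (congrFun (prodGradient_const_smul c)))).trans
        (MemLp.toLp_const_smul c (memLp_prodGradient hΩ hΩb φ))

variable (hΩ : MeasurableSet Ω) (hΩb : Bornology.IsBounded Ω)

theorem contDiffToH1_fst_ae_eq (φ : contDiffSubmodule d) :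
    (contDiffToH1 hΩ hΩb φ).1.fst =ᵐ[volume.restrict Ω] φ.1 :=
  (memLp_contDiff hΩ hΩb φ).coeFn_toLp

theorem contDiffToH1_snd_ae_eq (φ : contDiffSubmodule d) :
    (contDiffToH1 hΩ hΩb φ).1.snd =ᵐ[volume.restrict Ω] prodGradient φ.1 :=
  (memLp_prodGradient hΩ hΩb φ).coeFn_toLp

theorem ofReal_norm_contDiffToH1_sq (φ : contDiffSubmodule d) :
    ENNReal.ofReal (‖contDiffToH1 hΩ hΩb φ‖ ^ 2) = sobolevEnergy Ω φ.1 :=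
  ofReal_norm_sq_of_ae_eq (contDiffToH1_fst_ae_eq hΩ hΩb φ) (contDiffToH1_snd_ae_eq hΩ hΩb φ)

theorem isContinuousRep_contDiffToH1 (φ : contDiffSubmodule d) :
    IsContinuousRep (contDiffToH1 hΩ hΩb φ) φ.1 :=
  ⟨(contDiff_coe φ).continuous.continuousOn, contDiffToH1_fst_ae_eq hΩ hΩb φ⟩

theorem exists_tendsto_contDiffToH1 (hΩo : IsOpen Ω) (htrans : HasInwardTranslations Ω)
    (U : H1 Ω) :
    ∃ φ : ℕ → contDiffSubmodule d,
      Tendsto (fun k => contDiffToH1 hΩo.measurableSet hΩb (φ k)) atTop (𝓝 U) ∧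
      ∀ f, IsContinuousRep U f →
        TendstoUniformlyOn (fun k => (φ k).1) f atTop (closure Ω) := by
  obtain ⟨φ, hφ⟩ := HasWeakGradient.exists_isSmoothApproxOn_of_hasInwardTranslations U.2 hΩo hΩb
    htrans (Lp.stronglyMeasurable _) (Lp.stronglyMeasurable _) (Lp.memLp _) (Lp.memLp _)
  refine ⟨fun k => ⟨φ k, hφ.contDiff k⟩, tendsto_subtype_rng.2 ?_,
    fun f hf => hφ.tendstoUniformlyOn f hf.1 hf.2⟩
  exact tendsto_prod_Lp_of_ae_eq (fun k => contDiffToH1_fst_ae_eq _ hΩb _)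
    (fun k => contDiffToH1_snd_ae_eq _ hΩb _) hφ.tendsto_eLpNorm_sub
    hφ.tendsto_eLpNorm_prodGradient_sub

theorem denseRange_contDiffToH1 (hΩo : IsOpen Ω) (htrans : HasInwardTranslations Ω) :
    DenseRange (contDiffToH1 (d := d) hΩo.measurableSet hΩb) := by
  intro U
  obtain ⟨φ, tendsto_U, -⟩ := exists_tendsto_contDiffToH1 hΩb hΩo htrans U
  exact mem_closure_of_tendsto tendsto_U (.of_forall fun k => mem_range_self (φ k))

end ContDiffInH1

section FractionalSobolev

variable {d : ℕ} {ω : Set (𝔼^d)} {s : ℝ}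

theorem slobodeckijQuotient_congr_ae (s : ℝ) {u w : 𝔼^d → ℝ} (h : u =ᵐ[volume.restrict ω] w) :
    slobodeckijQuotient s u =ᵐ[(volume.restrict ω).prod (volume.restrict ω)]
      slobodeckijQuotient s w := by
  filter_upwards [Measure.quasiMeasurePreserving_fst.ae h, Measure.quasiMeasurePreserving_snd.ae h]
    with p h_fst h_snd
  simp only [slobodeckijQuotient, h_fst, h_snd]

theorem aestronglyMeasurable_slobodeckijQuotient (s : ℝ) {g : 𝔼^d → ℝ}
    (hg : AEStronglyMeasurable g (volume.restrict ω)) :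
    AEStronglyMeasurable (slobodeckijQuotient s g)
      ((volume.restrict ω).prod (volume.restrict ω)) := by
  unfold slobodeckijQuotient
  split_ifs
  · exact aestronglyMeasurable_const
  · exact ((hg.comp_fst.sub hg.comp_snd).aemeasurable.div (by fun_prop)).aestronglyMeasurable

theorem tendsto_slobodeckijQuotient {g : ℕ → 𝔼^d → ℝ} {g₀ : 𝔼^d → ℝ} {p : 𝔼^d × 𝔼^d}
    (h₁ : Tendsto (fun k => g k p.1) atTop (𝓝 (g₀ p.1)))
    (h₂ : Tendsto (fun k => g k p.2) atTop (𝓝 (g₀ p.2))) :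
    Tendsto (fun k => slobodeckijQuotient s (g k) p) atTop (𝓝 (slobodeckijQuotient s g₀ p)) := by
  unfold slobodeckijQuotient
  split_ifs
  · exact tendsto_const_nhds
  · exact (h₁.sub h₂).div_const _

theorem Hs_snd_ae_eq (U : Hs ω s) :
    U.1.snd =ᵐ[(volume.restrict ω).prod (volume.restrict ω)] slobodeckijQuotient s U.1.fst := U.2

theorem Hs_ext {U V : Hs ω s} (h : U.1.fst =ᵐ[volume.restrict ω] V.1.fst) : U = V :=
  Subtype.ext (WithLp.ofLp_injective 2 (Prod.ext (Lp.ext h) (Lp.ext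
    (((Hs_snd_ae_eq U).trans (slobodeckijQuotient_congr_ae s h)).trans (Hs_snd_ae_eq V).symm))))

theorem isClosed_Hs (ω : Set (𝔼^d)) (s : ℝ) : IsClosed (Hs ω s : Set (WithLp 2
    (Lp ℝ 2 (volume.restrict ω) × Lp ℝ 2 ((volume.restrict ω).prod (volume.restrict ω))))) := by
  refine IsSeqClosed.isClosed fun V V₀ hV hVV₀ => ?_
  obtain ⟨m, hm, fst_tendsto⟩ := exists_strictMono_tendsto_ae_of_tendsto_Lp
    (((WithLp.prod_continuous_ofLp 2 _ _).fst.tendsto V₀).comp hVV₀)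
  obtain ⟨n, hn, snd_tendsto⟩ := exists_strictMono_tendsto_ae_of_tendsto_Lp
    (((WithLp.prod_continuous_ofLp 2 _ _).snd.tendsto V₀).comp (hVV₀.comp hm.tendsto_atTop))
  filter_upwards [ae_all_iff.2 hV, snd_tendsto, Measure.quasiMeasurePreserving_fst.ae fst_tendsto,
    Measure.quasiMeasurePreserving_snd.ae fst_tendsto] with p quotient_eq snd_p fst_p₁ fst_p₂
  refine tendsto_nhds_unique snd_p ((tendsto_slobodeckijQuotient
    (fst_p₁.comp hn.tendsto_atTop) (fst_p₂.comp hn.tendsto_atTop)).congr fun k => ?_)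
  exact (quotient_eq _).symm

instance : CompleteSpace (Hs ω s) := (isClosed_Hs ω s).completeSpace_coe

theorem exists_Hs_of_lintegral_le {g : 𝔼^d → ℝ} (hg : AEStronglyMeasurable g (volume.restrict ω))
    {r : ℝ} (hr : 0 ≤ r) (h : (∫⁻ x in ω, ‖g x‖ₑ ^ 2) + ∫⁻ p, ‖slobodeckijQuotient s g p‖ₑ ^ 2
      ∂((volume.restrict ω).prod (volume.restrict ω)) ≤ ENNReal.ofReal (r ^ 2)) :
    ∃ V : Hs ω s, V.1.fst =ᵐ[volume.restrict ω] g ∧ ‖V‖ ≤ r := by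
  have h_eLpNorm := h
  rw [← sq_eLpNorm_two, ← sq_eLpNorm_two] at h_eLpNorm
  have lt_top := ENNReal.add_lt_top.1 (h_eLpNorm.trans_lt ENNReal.ofReal_lt_top)
  have hg2 : MemLp g 2 (volume.restrict ω) :=
    ⟨hg, (ENNReal.pow_lt_top_iff.1 lt_top.1).resolve_right two_ne_zero⟩
  have hq2 : MemLp (slobodeckijQuotient s g) 2 ((volume.restrict ω).prod (volume.restrict ω)) :=
    ⟨aestronglyMeasurable_slobodeckijQuotient s hg,
      (ENNReal.pow_lt_top_iff.1 lt_top.2).resolve_right two_ne_zero⟩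
  refine ⟨⟨WithLp.toLp 2 (hg2.toLp, hq2.toLp), hq2.coeFn_toLp.trans
    (slobodeckijQuotient_congr_ae s hg2.coeFn_toLp.symm)⟩, hg2.coeFn_toLp, ?_⟩
  refine (sq_le_sq₀ (norm_nonneg _) hr).1 ((ENNReal.ofReal_le_ofReal_iff (sq_nonneg r)).1 ?_)
  exact (ofReal_norm_sq_of_ae_eq hg2.coeFn_toLp hq2.coeFn_toLp).trans_le h

theorem exists_linearMap_Hs {M : Type*} [AddCommGroup M] [Module ℝ M] (L : M →ₗ[ℝ] 𝔼^d → ℝ)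
    {N : M → ℝ} (h : ∀ φ, ∃ V : Hs ω s, V.1.fst =ᵐ[volume.restrict ω] L φ ∧ ‖V‖ ≤ N φ) :
    ∃ T : M →ₗ[ℝ] Hs ω s, ∀ φ, (T φ).1.fst =ᵐ[volume.restrict ω] L φ ∧ ‖T φ‖ ≤ N φ := by
  choose T hT hTN using h
  refine ⟨{ toFun := T, map_add' := fun φ ψ => Hs_ext ?_, map_smul' := fun c φ => Hs_ext ?_ },
    fun φ => ⟨hT φ, hTN φ⟩⟩
  · refine (hT (φ + ψ)).trans ?_
    rw [map_add]
    exact ((hT φ).symm.add (hT ψ).symm).trans (Lp.coeFn_add _ _).symm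
  · refine (hT (c • φ)).trans ?_
    rw [map_smul]
    exact ((hT φ).symm.const_smul c).trans (Lp.coeFn_smul _ _).symm

theorem exists_continuousLinearMap_Hs {M E : Type*} [AddCommGroup M] [Module ℝ M]
    [NormedAddCommGroup E] [NormedSpace ℝ E] {e : M →ₗ[ℝ] E} (he : DenseRange e)
    (L : M →ₗ[ℝ] 𝔼^d → ℝ) {C : ℝ}
    (h : ∀ φ, ∃ V : Hs ω s, V.1.fst =ᵐ[volume.restrict ω] L φ ∧ ‖V‖ ≤ C * ‖e φ‖) :
    ∃ T : E →L[ℝ] Hs ω s, ∀ φ, (T (e φ)).1.fst =ᵐ[volume.restrict ω] L φ := by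
  obtain ⟨τ, hτ⟩ := exists_linearMap_Hs L h
  refine ⟨τ.extendOfNorm e, fun φ => ?_⟩
  rw [LinearMap.extendOfNorm_eq he ⟨C, fun φ => (hτ φ).2⟩]
  exact (hτ φ).1

end FractionalSobolev

section Trace

variable {d : ℕ} {ω : Set (𝔼^d)} {α H : ℝ≥0} {η : 𝔼^d → ℝ} {m s : ℝ}

theorem graph_mem_closure_subgraphDomain {x : 𝔼^d} (hx : x ∈ ω) (hη : 0 < η x) :
    (x, η x) ∈ closure (subgraphDomain ω η) :=
  map_mem_closure (f := fun t : ℝ => (x, t)) (s := Ioo 0 (η x)) (by fun_prop)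
    (by rw [closure_Ioo hη.ne]; exact right_mem_Icc.2 hη.le) fun _ ht => ⟨hx, ht⟩

theorem exists_graphTrace_continuousLinearMap (hω : IsOpen ω) (hω_bdd : Bornology.IsBounded ω)
    (hcone : HasInteriorCones ω) (hα1 : α ≤ 1) (hη : HolderOnWith H α η ω)
    (hηc : ContinuousOn η ω) (hm0 : 0 < m) (hm : ∀ x ∈ ω, m ≤ η x) (hs0 : 0 ≤ s)
    (hs : s < (α : ℝ) / 2) {hΩ : MeasurableSet (subgraphDomain ω η)}
    {hΩb : Bornology.IsBounded (subgraphDomain ω η)}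
    (dense_contDiff : DenseRange (contDiffToH1 hΩ hΩb)) :
    ∃ T : H1 (subgraphDomain ω η) →L[ℝ] Hs ω s, ∀ φ,
      (T (contDiffToH1 hΩ hΩb φ)).1.fst =ᵐ[volume.restrict ω] graphTrace η φ.1 := by
  have trace_bound := exists_lintegral_graphTrace_sq_add_slobodeckij_le hω hω_bdd hcone hα1 hη hm0
    hm hs0 hs
  obtain ⟨C, hC⟩ := trace_bound
  have exists_Hs (φ : contDiffSubmodule d) : ∃ V : Hs ω s,
      V.1.fst =ᵐ[volume.restrict ω] graphTrace η φ.1 ∧ ‖V‖ ≤ √C * ‖contDiffToH1 hΩ hΩb φ‖ := by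
    have graphTrace_aesm : AEStronglyMeasurable (graphTrace η φ.1) (volume.restrict ω) :=
      ((contDiff_coe φ).continuous.comp_continuousOn
        (continuousOn_id.prodMk hηc)).aestronglyMeasurable hω.measurableSet
    refine exists_Hs_of_lintegral_le graphTrace_aesm (by positivity) ?_
    rw [mul_pow, Real.sq_sqrt C.coe_nonneg, ENNReal.ofReal_mul C.coe_nonneg,
      ofReal_norm_contDiffToH1_sq, ENNReal.ofReal_coe_nnreal]
    exact hC φ.1 (contDiff_coe φ)
  let γ : contDiffSubmodule d →ₗ[ℝ] 𝔼^d → ℝ :=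
    LinearMap.funLeft ℝ ℝ (fun x => (x, η x)) ∘ₗ (contDiffSubmodule d).subtype
  exact exists_continuousLinearMap_Hs dense_contDiff γ exists_Hs

theorem ae_eq_graphTrace_of_tendsto (hω : MeasurableSet ω) (hη0 : ∀ x ∈ ω, 0 < η x)
    {V : ℕ → Hs ω s} {V₀ : Hs ω s} (hVV₀ : Tendsto V atTop (𝓝 V₀)) {φ : ℕ → 𝔼^d × ℝ → ℝ}
    (hV : ∀ k, (V k).1.fst =ᵐ[volume.restrict ω] graphTrace η (φ k)) {f : 𝔼^d × ℝ → ℝ}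
    (hφ : TendstoUniformlyOn φ f atTop (closure (subgraphDomain ω η))) :
    V₀.1.fst =ᵐ[volume.restrict ω] graphTrace η f := by
  have fst_tendsto : Tendsto (fun k => (V k).1.fst) atTop (𝓝 V₀.1.fst) :=
    ((WithLp.prod_continuous_ofLp 2 _ _).fst.tendsto V₀.1).comp (tendsto_subtype_rng.1 hVV₀)
  obtain ⟨n, hn, tendsto_V₀⟩ := exists_strictMono_tendsto_ae_of_tendsto_Lp fst_tendsto
  filter_upwards [tendsto_V₀, ae_all_iff.2 hV, ae_restrict_mem hω] with x hx hVx hxω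
  have trace_tendsto : Tendsto (fun k => graphTrace η (φ k) x) atTop (𝓝 (graphTrace η f x)) :=
    hφ.tendsto_at (graph_mem_closure_subgraphDomain hxω (hη0 x hxω))
  simp only [hVx] at hx
  exact tendsto_nhds_unique hx (trace_tendsto.comp hn.tendsto_atTop)

theorem ae_eq_graphTrace_of_isContinuousRep (hω : MeasurableSet ω) (hη0 : ∀ x ∈ ω, 0 < η x)
    (hΩ : IsOpen (subgraphDomain ω η)) (hΩb : Bornology.IsBounded (subgraphDomain ω η))
    (htrans : HasInwardTranslations (subgraphDomain ω η))
    {T : H1 (subgraphDomain ω η) →L[ℝ] Hs ω s} (hT : ∀ φ,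
      (T (contDiffToH1 hΩ.measurableSet hΩb φ)).1.fst =ᵐ[volume.restrict ω] graphTrace η φ.1)
    {U : H1 (subgraphDomain ω η)} {f : 𝔼^d × ℝ → ℝ} (hf : IsContinuousRep U f) :
    (T U).1.fst =ᵐ[volume.restrict ω] graphTrace η f := by
  have exists_approx := exists_tendsto_contDiffToH1 hΩb hΩ htrans U
  obtain ⟨φ, tendsto_U, hφ⟩ := exists_approx
  exact ae_eq_graphTrace_of_tendsto hω hη0 ((T.continuous.tendsto U).comp tendsto_U)
    (fun k => hT (φ k)) (hφ f hf)

end Trace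

end

theorem theorem1_general {d : ℕ} {ω : Set (EuclideanSpace ℝ (Fin d))} (hω : IsOpen ω)
    (hω_bdd : Bornology.IsBounded ω) (hcone : HasInteriorCones ω) {α H : ℝ≥0} (hα1 : α ≤ 1)
    {η : EuclideanSpace ℝ (Fin d) → ℝ} (hη : HolderOnWith H α η ω) {ηmin : ℝ} (hmin0 : 0 < ηmin)
    (hmin : ∀ x ∈ ω, ηmin ≤ η x) {s : ℝ} (hs0 : 0 ≤ s) (hs : s < (α : ℝ) / 2) :
    Dense {U : H1 (subgraphDomain ω η) | ∃ f, IsContinuousRep U f} ∧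
    ∃! T : H1 (subgraphDomain ω η) →L[ℝ] Hs ω s,
      ∀ (U : H1 (subgraphDomain ω η)) (f : EuclideanSpace ℝ (Fin d) × ℝ → ℝ),
        IsContinuousRep U f → (T U).1.fst =ᵐ[volume.restrict ω] graphTrace η f := by
  have hα0 : 0 < α := NNReal.coe_pos.1 (by linarith)
  have hηu := hη.uniformContinuousOn hα0
  have hΩ := isOpen_subgraphDomain hω hηu.continuousOn
  have hΩb := isBounded_subgraphDomain hω_bdd (isBounded_image_of_holderOnWith hη hω_bdd).bddAbove
  have htrans := hasInwardTranslations_subgraphDomain hcone hηu hmin0 hmin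
  have dense_contDiff := denseRange_contDiffToH1 hΩb hΩ htrans
  have dense_continuous : Dense {U : H1 (subgraphDomain ω η) | ∃ f, IsContinuousRep U f} :=
    dense_contDiff.mono (Set.range_subset_iff.2 fun φ => ⟨_, isContinuousRep_contDiffToH1 _ hΩb φ⟩)
  have exists_trace := exists_graphTrace_continuousLinearMap hω hω_bdd hcone hα1 hη hηu.continuousOn
    hmin0 hmin hs0 hs dense_contDiff
  obtain ⟨T, hT⟩ := exists_trace
  have T_eq_graphTrace (U : H1 (subgraphDomain ω η)) (f) (hf : IsContinuousRep U f) :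
      (T U).1.fst =ᵐ[volume.restrict ω] graphTrace η f :=
    ae_eq_graphTrace_of_isContinuousRep hω.measurableSet
      (fun x hx => hmin0.trans_le (hmin x hx)) hΩ hΩb htrans hT hf
  refine ⟨dense_continuous, T, T_eq_graphTrace, fun T' hT' => DFunLike.coe_injective
    (T'.continuous.ext_on dense_continuous T.continuous ?_)⟩
  rintro U ⟨f, hf⟩
  exact Hs_ext ((hT' U f hf).trans (T_eq_graphTrace U f hf).symm)

/-- With `d = n - 1 ≥ 1`. "Extends by continuity": the functions of `H¹(Ω_η)` that are continuous up
to the boundary are dense, and there is exactly one bounded linear operator `H¹(Ω_η) → H^s(ω)` that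
is `γ_η` on them. -/
theorem theorem1 {d : ℕ} (hd : 1 ≤ d) {ω : Set (EuclideanSpace ℝ (Fin d))}
    (hω : IsLipschitzDomain ω) {α : ℝ≥0} (hα0 : 0 < α) (hα1 : α < 1)
    {η : EuclideanSpace ℝ (Fin d) → ℝ} (hη : ∃ C : ℝ≥0, HolderOnWith C α η (closure ω))
    {ηmin : ℝ} (hmin0 : 0 < ηmin) (hmin : ∀ x ∈ closure ω, ηmin ≤ η x)
    (hη1 : ∀ x ∈ frontier ω, η x = 1) {s : ℝ} (hs0 : 0 ≤ s) (hs : s < (α : ℝ) / 2) :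
    Dense {U : H1 (subgraphDomain ω η) | ∃ f, IsContinuousRep U f} ∧
    ∃! T : H1 (subgraphDomain ω η) →L[ℝ] Hs ω s,
      ∀ (U : H1 (subgraphDomain ω η)) (f : EuclideanSpace ℝ (Fin d) × ℝ → ℝ),
        IsContinuousRep U f → (T U).1.fst =ᵐ[volume.restrict ω] graphTrace η f := by
  obtain ⟨H, hη⟩ := hη
  exact theorem1_general hω.isOpen hω.isBounded hω.hasInteriorCones hα1.le (hη.mono subset_closure)
    hmin0 (fun x hx => hmin x (subset_closure hx)) hs0 hs
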